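/- **Setting.** Let $\Psi$ be the Dynkin diagram $A_n$ (nodes $s_1,\dots,s_n$ along a chain) or $E_6$ (nodes $s_1,\dots,s_5$ along a chain, and $s_6$ joined to $s_3$), with Weyl group $W(\Psi)$ of rank $n$, simple roots $x_1,\dots,x_n$ and root lattice $L=\mathbb Z x_1\oplus\dots\oplus\mathbb Z x_n$. For a node $s$ let $u_s\in L$ be the primitive integral multiple of the simple weight of $s$, i.e. the primitive vector of $L$ (unique up to sign) orthogonal to $x_t$ for all nodes $t\ne s$; let $\overline u_s$ be its class in $L/2=L/2L$, and let $\Lambda_s/2\subset L/2$ be the $\mathbb F_2$-subspace spanned by the $W(\Psi)$-orbit of $\overline u_s$. For a path in $\Psi$ starting at $s$ and with successive nodes $r_1=s,r_2,\dots,r_k$, consider the $k+1$ vectors $\overline u_s,\ r_1\overline u_s,\ r_2r_1\overline u_s,\dots,\ r_k\cdots r_1\overline u_s$ of $L/2$. The pair $(\Psi,s)$ is *admissible* if these are linearly independent for each path from $s$ with an odd number $k$ of nodes, and *specially admissible* if they are linearly independent for every path from $s$. Let $m\ge 1$, let $s_{j_1},\dots,s_{j_m}$ be nodes of $\Psi$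 such that every $(\Psi,s_{j_i})$ is admissible, and let $\ell$ be the number of indices $i$ for which $(\Psi,s_{j_i})$ is not specially admissible. Let $\Gamma$ be the Coxeter symbol obtained from $\Psi$ by adding nodes $t_1,\dots,t_m$, pairwise not joined, with $t_i$ joined to $s_{j_i}$ by an edge labelled $4$ and to no other node of $\Psi$; let $W(\Gamma)$ be its Coxeter group. Let $W(\Psi)$ act diagonally on $\prod_{i=1}^m\Lambda_{s_{j_i}}/2$, and let $$\widehat\varphi:W(\Gamma)\to(\mathbb Z/2)^\ell\times\Bigl(\prod_{i=1}^m\Lambda_{s_{j_i}}/2\rtimes W(\Psi)\Bigr)$$ be the homomorphism with $\widehat\varphi(s)=(\mathbf 0,\mathbf 0,s)$ for $s\in\Psi$ and $\widehat\varphi(t_i)=(\mathbf x_i,\mathbf u_i,1)$, where $\mathbf u_i$ has $\overline u_{s_{j_i}}$ in position $i$ and $0$ elsewhere, and the coordinates of $\mathbf x_i$ are indexed by the $\ell$ indices above, with the coordinate of index $i$ (if present) equal to $1$ and all others equal to $0$. **Theorem.** (i) Let $\Psi=A_n$ with $n$ odd, let $\xi=s_1\cdots s_n$, and let $h$ be the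 Coxeter number, the order of $\xi$. Then for some $\mathbf u\in\prod_i\Lambda_{s_{j_i}}/2$ the element $\zeta=(\mathbf 0,\mathbf u,\xi^{h/2})$ generates a subgroup $\langle\zeta\rangle\cong\mathbb Z/2$ such that $\widehat\varphi^{-1}\langle\zeta\rangle\subset W(\Gamma)$ is torsion free. (ii) Let $\Psi=E_6$ and let $\xi=s_2s_3s_4s_5s_6$, a Coxeter element of the visible subgroup $W(D_5)=\langle s_2,\dots,s_6\rangle$. Then for some $\mathbf u\in\prod_i\Lambda_{s_{j_i}}/2$ the element $\zeta=(\mathbf 0,\mathbf u,\xi)$ generates a subgroup $\langle\zeta\rangle\cong\mathbb Z/2^3$ such that $\widehat\varphi^{-1}\langle\zeta\rangle\subset W(\Gamma)$ is torsion free. Moreover its index satisfies $$2\,[W(\Gamma):\widehat\varphi^{-1}\langle\zeta\rangle]=2^{6m+\ell-2}\prod_{i=1}^6(m_i+1),$$ where $m_1,\dots,m_6=1,4,5,7,8,11$ are the exponents of $W(E_6)$. (The right hand side is the index $2^{mn+\ell-p}\prod_i(m_i+1)$ of the torsion free subgroup that is obtained in the same way from a Coxeter element of $W(E_6)$ itself,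 whose order is $h=12=2^p\cdot 3$ with $p=2$.) -/

import Mathlib

open scoped BigOperators

noncomputable section

namespace WeylExt

/-! ### The reflectional representation of a simply laced Coxeter group -/

/-- The matrix `2 B(v_i, v_j) = -2 cos (π / m_ij)` of a simply laced Coxeter matrix,
an integer matrix. -/
def cartan {ι : Type*} [DecidableEq ι] (M : CoxeterMatrix ι) (i j : ι) : ℤ :=
  if i = j then 2 else if M i j = 3 then -1 else 0

/-- A Coxeter matrix is simply laced if all its labels are at most `3` (and finite). -/
def SimplyLaced {ι : Type*} (M : CoxeterMatrix ι) : Prop :=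
  ∀ i j, M i j = 1 ∨ M i j = 2 ∨ M i j = 3

theorem cartan_eq_two_mul_form {ι : Type*} [DecidableEq ι] (M : CoxeterMatrix ι)
    (hM : SimplyLaced M) (i j : ι) :
    (cartan M i j : ℝ) = 2 * -Real.cos (Real.pi / (M i j : ℝ)) := by
  unfold cartan
  by_cases h : i = j
  · subst h
    simp
  · rcases hM i j with h1 | h2 | h3
    · exact absurd h1 (M.off_diagonal i j h)
    · simp [h, h2]
    · simp [h, h3]

theorem cartan_self {ι : Type*} [DecidableEq ι] (M : CoxeterMatrix ι) (i : ι) :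
    cartan M i i = 2 := by simp [cartan]

theorem cartan_symm {ι : Type*} [DecidableEq ι] (M : CoxeterMatrix ι) (i j : ι) :
    cartan M i j = cartan M j i := by
  unfold cartan
  rw [M.symmetric i j]
  simp only [eq_comm]

/-- The linear form `v ↦ 2 B(v, v_t)`, in the coordinates of the basis `(v_j)`, with
coefficients in `R`. -/
def pairing (R : Type*) [CommRing R] {ι : Type*} [Fintype ι] [DecidableEq ι]
    (M : CoxeterMatrix ι) (t : ι) : (ι → R) →ₗ[R] R where
  toFun v := ∑ j, v j * (cartan M j t : R)
  map_add' v w := by simp [add_mul, Finset.sum_add_distrib]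
  map_smul' c v := by simp [Finset.mul_sum, mul_assoc]

theorem pairing_single (R : Type*) [CommRing R] {ι : Type*} [Fintype ι] [DecidableEq ι]
    (M : CoxeterMatrix ι) (t i : ι) :
    pairing R M t (Pi.single i 1) = (cartan M i t : R) := by
  simp [pairing, Pi.single_apply]

/-- The reflection `v ↦ v - 2 B(v, v_t) v_t`, in the coordinates of the basis `(v_j)`:
for `R = ℝ` on the reflectional representation, for `R = ℤ` on the root lattice `L`,
for `R = ZMod 2` on `L / 2L`. -/
def reflection (R : Type*) [CommRing R] {ι : Type*} [Fintype ι] [DecidableEq ι]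
    (M : CoxeterMatrix ι) (t : ι) : Module.End R (ι → R) :=
  LinearMap.id - (pairing R M t).smulRight (Pi.single t 1)

theorem reflection_apply (R : Type*) [CommRing R] {ι : Type*} [Fintype ι] [DecidableEq ι]
    (M : CoxeterMatrix ι) (t : ι) (v : ι → R) :
    reflection R M t v = v - pairing R M t v • Pi.single t 1 := by
  simp [reflection]

theorem reflection_sq (R : Type*) [CommRing R] {ι : Type*} [Fintype ι] [DecidableEq ι]
    (M : CoxeterMatrix ι) (t : ι) : reflection R M t * reflection R M t = 1 := by
  refine LinearMap.ext fun v => ?_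
  simp only [Module.End.mul_apply, reflection_apply, map_sub, map_smul, pairing_single,
    cartan_self, Module.End.one_apply]
  push_cast
  module

theorem reflection_liftable (R : Type*) [CommRing R] {ι : Type*} [Fintype ι] [DecidableEq ι]
    (M : CoxeterMatrix ι) (hM : SimplyLaced M) : M.IsLiftable (reflection R M) := by
  intro i j
  by_cases hij : i = j
  · subst hij
    rw [M.diagonal, pow_one, reflection_sq]
  · have hji : ¬ j = i := fun h => hij h.symm
    rcases hM i j with h1 | h2 | h3
    · exact absurd h1 (M.off_diagonal i j hij)
    · have hc : cartan M i j = 0 := by simp [cartan, hij, h2]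
      have hc' : cartan M j i = 0 := by rw [cartan_symm, hc]
      rw [h2]
      refine LinearMap.ext fun v => ?_
      simp only [pow_succ, pow_zero, one_mul, Module.End.mul_apply, reflection_apply, map_sub,
        map_smul, pairing_single, cartan_self, hc, hc', Module.End.one_apply]
      push_cast
      module
    · have hc : cartan M i j = -1 := by simp [cartan, hij, h3]
      have hc' : cartan M j i = -1 := by rw [cartan_symm, hc]
      rw [h3]
      refine LinearMap.ext fun v => ?_
      simp only [pow_succ, pow_zero, one_mul, Module.End.mul_apply, reflection_apply, map_sub,
        map_smul, pairing_single, cartan_self, hc, hc', Module.End.one_apply]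
      push_cast
      module

/-! ### Symbols with their vectors `u_s` -/

/-- The symbol `Ψ` of a simply laced Weyl group, together with vectors `u_s` of the root lattice
(in the coordinates of the basis of simple roots), one for each node `s`, with `u_s` orthogonal to
all simple roots other than the one of `s`. Used only for the two symbols `typeA n` and
`typeE6` below. -/
structure Symbol (ι : Type*) [Fintype ι] [DecidableEq ι] where
  cox : CoxeterMatrix ι
  simplyLaced : SimplyLaced cox
  u : ι → ι → ℤ
  u_orth : ∀ s t, t ≠ s → pairing ℤ cox t (u s) = 0

/-- The vector `u_s` for the node `s` (numbered from `0`) of `A_n`: with `l = s + 1` and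
`k = n - s` nodes from `s`, included, to the two ends, and `d = gcd (l, k)`, its coordinates are
`k/d, 2k/d, …, lk/d, (k-1)l/d, …, 2l/d, l/d`. -/
def uA (n : ℕ) (s j : Fin n) : ℤ :=
  if (j : ℕ) ≤ s then (((j : ℕ) + 1) * ((n - s) / Nat.gcd (s + 1) (n - s)) : ℕ)
  else ((n - j) * ((s + 1) / Nat.gcd (s + 1) (n - s)) : ℕ)

theorem pairing_typeA (n : ℕ) (t : Fin n) (f : ℕ → ℤ) (h0 : f 0 = 0) (h1 : f (n + 1) = 0) :
    pairing ℤ (CoxeterMatrix.A n) t (fun j => f (j + 1)) = 2 * f (t + 1) - f t - f (t + 2) := by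
  have hc : ∀ j : Fin n, f (j + 1) * cartan (CoxeterMatrix.A n) j t =
      (if (j : ℕ) = t then 2 * f (j + 1) else 0) - (if (j : ℕ) + 1 = t then f (j + 1) else 0)
        - (if (j : ℕ) = t + 1 then f (j + 1) else 0) := by
    intro j
    simp only [cartan, CoxeterMatrix.A, Matrix.of_apply, Fin.ext_iff]
    split_ifs <;> omega
  have hs : pairing ℤ (CoxeterMatrix.A n) t (fun j => f (j + 1)) =
      ∑ j ∈ Finset.range n, ((if j = (t : ℕ) then 2 * f (j + 1) else 0)
        - (if j + 1 = (t : ℕ) then f (j + 1) else 0)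
        - (if j = (t : ℕ) + 1 then f (j + 1) else 0)) := by
    rw [← Fin.sum_univ_eq_sum_range (fun j => ((if j = (t : ℕ) then 2 * f (j + 1) else 0)
        - (if j + 1 = (t : ℕ) then f (j + 1) else 0)
        - (if j = (t : ℕ) + 1 then f (j + 1) else 0)))]
    simp only [pairing, LinearMap.coe_mk, AddHom.coe_mk, Int.cast_id]
    exact Finset.sum_congr rfl fun j _ => hc j
  rw [hs, Finset.sum_sub_distrib, Finset.sum_sub_distrib]
  have e1 : ∑ j ∈ Finset.range n, (if j = (t : ℕ) then 2 * f (j + 1) else 0) =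
      2 * f (t + 1) := by
    rw [Finset.sum_ite_eq' (Finset.range n) (t : ℕ) (fun j => 2 * f (j + 1))]
    simp
  have e2 : ∑ j ∈ Finset.range n, (if j + 1 = (t : ℕ) then f (j + 1) else 0) = f t := by
    rcases Nat.eq_zero_or_pos (t : ℕ) with h | h
    · rw [h, h0]
      exact Finset.sum_eq_zero fun j _ => by simp
    · obtain ⟨k, hk⟩ := Nat.exists_eq_add_of_lt h
      have hk' : (t : ℕ) = k + 1 := by omega
      have hkn : k < n := by have := t.2; omega
      rw [hk']
      simp only [Nat.add_right_cancel_iff]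
      rw [Finset.sum_ite_eq' (Finset.range n) k (fun j => f (j + 1))]
      simp [hkn]
  have e3 : ∑ j ∈ Finset.range n, (if j = (t : ℕ) + 1 then f (j + 1) else 0) = f (t + 2) := by
    rw [Finset.sum_ite_eq' (Finset.range n) ((t : ℕ) + 1) (fun j => f (j + 1))]
    by_cases h : (t : ℕ) + 1 < n
    · simp [h]
    · have ht : (t : ℕ) + 2 = n + 1 := by have := t.2; omega
      simp [h, ht, h1]
  rw [e1, e2, e3]

theorem uA_orth (n : ℕ) (s t : Fin n) (h : t ≠ s) :
    pairing ℤ (CoxeterMatrix.A n) t (uA n s) = 0 := by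
  have hsn := s.2
  have htn := t.2
  have hts : (t : ℕ) ≠ s := fun h' => h (Fin.ext h')
  obtain ⟨a, ha⟩ := Nat.gcd_dvd_right ((s : ℕ) + 1) (n - s)
  obtain ⟨b, hb⟩ := Nat.gcd_dvd_left ((s : ℕ) + 1) (n - s)
  have hd : 0 < Nat.gcd ((s : ℕ) + 1) (n - s) := Nat.gcd_pos_of_pos_left _ (by omega)
  have hA : (n - s) / Nat.gcd ((s : ℕ) + 1) (n - s) = a := Nat.div_eq_of_eq_mul_right hd ha
  have hB : ((s : ℕ) + 1) / Nat.gcd ((s : ℕ) + 1) (n - s) = b := Nat.div_eq_of_eq_mul_right hd hb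
  have hab : ((s : ℤ) + 1) * a = ((n : ℤ) - s) * b := by
    have h1 : ((s : ℕ) + 1) * a = (n - s) * b := by
      generalize Nat.gcd ((s : ℕ) + 1) (n - s) = d at ha hb
      rw [ha, hb]
      ring
    have h2 := congrArg (fun x : ℕ => (x : ℤ)) h1
    push_cast [Nat.cast_sub hsn.le] at h2
    exact h2
  let f : ℕ → ℤ := fun i => if i ≤ s + 1 then (i : ℤ) * a else ((n : ℤ) + 1 - i) * b
  have hf : uA n s = fun j : Fin n => f (j + 1) := by
    funext j
    have hj := j.2
    simp only [uA, f, hA, hB, Nat.add_le_add_iff_right]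
    split_ifs
    · push_cast
      ring
    · push_cast [Nat.cast_sub hj.le]
      ring
  have h0 : f 0 = 0 := by simp [f]
  have h1 : f (n + 1) = 0 := by
    have : ¬ n + 1 ≤ (s : ℕ) + 1 := by omega
    simp only [f, if_neg this]
    push_cast
    ring
  rw [hf, pairing_typeA n t f h0 h1]
  rcases Nat.lt_or_gt_of_ne hts with hlt | hgt
  · have c1 : (t : ℕ) + 1 ≤ s + 1 := by omega
    have c2 : (t : ℕ) ≤ s + 1 := by omega
    have c3 : (t : ℕ) + 2 ≤ s + 1 := by omega
    simp only [f, if_pos c1, if_pos c2, if_pos c3]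
    push_cast
    ring
  · have c1 : ¬ (t : ℕ) + 1 ≤ s + 1 := by omega
    have c3 : ¬ (t : ℕ) + 2 ≤ s + 1 := by omega
    simp only [f, if_neg c1, if_neg c3]
    split_ifs with c2
    · have ht : (t : ℕ) = s + 1 := by omega
      rw [ht]
      push_cast
      linear_combination -hab
    · push_cast
      ring

/-- The symbol `A_n`, with nodes numbered along the chain. -/
def typeA (n : ℕ) : Symbol (Fin n) where
  cox := CoxeterMatrix.A n
  simplyLaced i j := by
    simp only [CoxeterMatrix.A, Matrix.of_apply]
    split_ifs <;> simp
  u := uA n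
  u_orth := uA_orth n

/-- The Coxeter matrix of `E_6`, with the numbering `s_1 — s_2 — s_3 — s_4 — s_5` along the chain
and `s_6` joined to `s_3` (here shifted to `0, …, 5`). -/
def coxE6 : CoxeterMatrix (Fin 6) where
  M := !![1, 3, 2, 2, 2, 2;
          3, 1, 3, 2, 2, 2;
          2, 3, 1, 3, 2, 3;
          2, 2, 3, 1, 3, 2;
          2, 2, 2, 3, 1, 2;
          2, 2, 3, 2, 2, 1]
  isSymm := by ext i j; fin_cases i <;> fin_cases j <;> rfl
  diagonal i := by fin_cases i <;> rfl
  off_diagonal i j h := by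
    fin_cases i <;> fin_cases j <;> first | exact absurd rfl h | simp [Matrix.of_apply]

/-- The vectors `u_s` for the nodes of `E_6`: the row of `s` is the primitive integral multiple of
the simple weight of `s`. -/
def uE6 : Fin 6 → Fin 6 → ℤ :=
  !![4, 5, 6, 4, 2, 3;
     5, 10, 12, 8, 4, 6;
     2, 4, 6, 4, 2, 3;
     4, 8, 12, 10, 5, 6;
     2, 4, 6, 5, 4, 3;
     1, 2, 3, 2, 1, 2]

/-- The symbol `E_6`. -/
def typeE6 : Symbol (Fin 6) where
  cox := coxE6
  simplyLaced i j := by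
    fin_cases i <;> fin_cases j <;>
      first | exact Or.inl rfl | exact Or.inr (Or.inl rfl) | exact Or.inr (Or.inr rfl)
  u := uE6
  u_orth s t h := by
    fin_cases s <;> fin_cases t <;> first | exact absurd rfl h | rfl

namespace Symbol

variable {ι : Type*} [Fintype ι] [DecidableEq ι]

/-- The Weyl group `W(Ψ)`. -/
abbrev W (Ψ : Symbol ι) : Type _ := Ψ.cox.Group

/-- The representation of `W(Ψ)` by reflections, in the coordinates of the basis of simple
roots: for `R = ℝ` the reflectional representation, for `R = ℤ` the action on the root lattice
`L`, for `R = ZMod 2` the action on `L / 2L`. -/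
def rep (Ψ : Symbol ι) (R : Type*) [CommRing R] : Ψ.W →* Module.End R (ι → R) :=
  Ψ.cox.toCoxeterSystem.lift ⟨reflection R Ψ.cox, reflection_liftable R Ψ.cox Ψ.simplyLaced⟩

theorem rep_simple (Ψ : Symbol ι) (R : Type*) [CommRing R] (i : ι) :
    Ψ.rep R (Ψ.cox.simple i) = reflection R Ψ.cox i :=
  Ψ.cox.toCoxeterSystem.lift_apply_simple _ i

/-- The class of a vector of the root lattice `L` in `L / 2L`. -/
def red (v : ι → ℤ) : ι → ZMod 2 := fun j => (v j : ZMod 2)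

/-- The class of `u_s` in `L / 2L`. -/
def ubar (Ψ : Symbol ι) (s : ι) : ι → ZMod 2 := red (Ψ.u s)

theorem reflection_red (M : CoxeterMatrix ι) (t : ι) (v : ι → ℤ) :
    reflection (ZMod 2) M t (red v) = red (reflection ℤ M t v) := by
  funext j
  simp [reflection_apply, red, pairing, Pi.single_apply]

/-- The action on `L / 2L` is induced by the one on `L`. -/
theorem rep_red (Ψ : Symbol ι) (g : Ψ.W) (v : ι → ℤ) :
    Ψ.rep (ZMod 2) g (red v) = red (Ψ.rep ℤ g v) := by
  induction g using Ψ.cox.toCoxeterSystem.simple_induction_left generalizing v with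
  | one => simp
  | mul_simple_left w i ih =>
    rw [CoxeterMatrix.toCoxeterSystem_simple, map_mul, map_mul, Module.End.mul_apply,
      Module.End.mul_apply, ih, rep_simple, rep_simple, reflection_red]

theorem reflection_ubar (Ψ : Symbol ι) (s t : ι) (h : t ≠ s) :
    reflection (ZMod 2) Ψ.cox t (Ψ.ubar s) = Ψ.ubar s := by
  rw [ubar, reflection_red, reflection_apply, Ψ.u_orth s t h]
  simp

/-! ### Admissibility -/

/-- The graph underlying the symbol `Ψ`. -/
def graph (Ψ : Symbol ι) : SimpleGraph ι where
  Adj i j := Ψ.cox i j = 3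
  symm := ⟨fun i j h => by rw [Ψ.cox.symmetric]; exact h⟩
  loopless := ⟨fun i h => by rw [Ψ.cox.diagonal] at h; omega⟩

/-- For the list `[s_1, …, s_k]` of the nodes of a path from `s` to `t`, the list
`[ū_s, s_1 ū_s, s_2 s_1 ū_s, …, s_k ⋯ s_1 ū_s]` of the `k + 1` elements of `X^s_t`. -/
def vectorsX (Ψ : Symbol ι) (s : ι) (path : List ι) : List (ι → ZMod 2) :=
  path.scanl (fun v i => Ψ.rep (ZMod 2) (Ψ.cox.simple i) v) (Ψ.ubar s)

/-- The `k + 1` vectors attached to a path with `k` nodes are linearly independent. -/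
def IndependentAlong (Ψ : Symbol ι) (s : ι) (path : List ι) : Prop :=
  LinearIndependent (ZMod 2) (fun j => (Ψ.vectorsX s path).get j)

/-- `(Ψ, s)` is admissible: `{t}` is independent for `s` whenever the path from `s` to `t` spans a
subsymbol of type `A` of odd rank. (The symbols considered are simply laced trees, so the path
is unique and always spans a subsymbol of type `A`, of rank its number of nodes.) -/
def Admissible (Ψ : Symbol ι) (s : ι) : Prop :=
  ∀ (t : ι) (p : Ψ.graph.Walk s t), p.IsPath → Odd p.support.length →
    Ψ.IndependentAlong s p.support

/-- `(Ψ, s)` is specially admissible: `{t}` is independent for `s` whenever the path from `s` to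
`t` spans a subsymbol of type `A`. -/
def SpeciallyAdmissible (Ψ : Symbol ι) (s : ι) : Prop :=
  ∀ (t : ι) (p : Ψ.graph.Walk s t), p.IsPath → Ψ.IndependentAlong s p.support

/-! ### The extended Coxeter group and the homomorphism -/

/-- The Coxeter matrix of the symbol `Γ`, obtained from `Ψ` by adding new nodes `t_1, …, t_m`,
pairwise not joined, with `t_i` joined to the node `s_i` of `Ψ` by an edge labelled `4`, and to no
other node of `Ψ`. -/
def extend (Ψ : Symbol ι) {m : ℕ} (s : Fin m → ι) : CoxeterMatrix (ι ⊕ Fin m) where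
  M := Matrix.of fun a b => match a, b with
    | .inl i, .inl j => Ψ.cox i j
    | .inl i, .inr b => if i = s b then 4 else 2
    | .inr a, .inl j => if j = s a then 4 else 2
    | .inr a, .inr b => if a = b then 1 else 2
  isSymm := by
    ext a b
    rcases a with i | a <;> rcases b with j | b <;> simp [Matrix.transpose_apply, eq_comm]
    exact Ψ.cox.symmetric i j
  diagonal := by
    rintro (i | a)
    · simp
    · simp
  off_diagonal := by
    rintro (i | a) (j | b) h
    · simpa using Ψ.cox.off_diagonal i j (fun h' => h (by rw [h']))
    · simp only [Matrix.of_apply]; split_ifs <;> simp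
    · simp only [Matrix.of_apply]; split_ifs <;> simp
    · have : a ≠ b := fun h' => h (by rw [h'])
      simp [this]

/-- The subspace `Λ_s / 2` of `L / 2L`, spanned by the `W(Ψ)`-orbit of `ū_s`. -/
def Lam (Ψ : Symbol ι) (s : ι) : Submodule (ZMod 2) (ι → ZMod 2) :=
  Submodule.span (ZMod 2) (Set.range fun g : Ψ.W => Ψ.rep (ZMod 2) g (Ψ.ubar s))

theorem rep_mem_Lam (Ψ : Symbol ι) (s : ι) (g : Ψ.W) {v : ι → ZMod 2} (hv : v ∈ Ψ.Lam s) :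
    Ψ.rep (ZMod 2) g v ∈ Ψ.Lam s := by
  have h : (Ψ.Lam s).map (Ψ.rep (ZMod 2) g) ≤ Ψ.Lam s := by
    rw [Lam, Submodule.map_span, Submodule.span_le]
    rintro _ ⟨_, ⟨k, rfl⟩, rfl⟩
    refine Submodule.subset_span ⟨g * k, ?_⟩
    simp
  exact h ⟨v, hv, rfl⟩

theorem ubar_mem_Lam (Ψ : Symbol ι) (s : ι) : Ψ.ubar s ∈ Ψ.Lam s :=
  Submodule.subset_span ⟨1, by simp⟩

/-- The product of the `Λ_{s_i} / 2`, `1 ≤ i ≤ m`. -/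
abbrev V (Ψ : Symbol ι) {m : ℕ} (s : Fin m → ι) : Type _ := ∀ i : Fin m, Ψ.Lam (s i)

/-- The diagonal action of `W(Ψ)` on the product of the `Λ_{s_i} / 2`. -/
def act (Ψ : Symbol ι) {m : ℕ} (s : Fin m → ι) : Ψ.W →* MulAut (Multiplicative (Ψ.V s)) where
  toFun g :=
    { toFun := fun v => Multiplicative.ofAdd fun i =>
        ⟨Ψ.rep (ZMod 2) g (v.toAdd i), Ψ.rep_mem_Lam (s i) g (v.toAdd i).2⟩
      invFun := fun v => Multiplicative.ofAdd fun i =>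
        ⟨Ψ.rep (ZMod 2) g⁻¹ (v.toAdd i), Ψ.rep_mem_Lam (s i) g⁻¹ (v.toAdd i).2⟩
      left_inv := fun v => by
        apply Multiplicative.toAdd.injective
        funext i
        apply Subtype.ext
        simp [← Module.End.mul_apply, ← map_mul]
      right_inv := fun v => by
        apply Multiplicative.toAdd.injective
        funext i
        apply Subtype.ext
        simp [← Module.End.mul_apply, ← map_mul]
      map_mul' := fun v w => by
        apply Multiplicative.toAdd.injective
        funext i
        apply Subtype.ext
        simp }
  map_one' := by
    ext v : 1
    apply Multiplicative.toAdd.injective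
    funext i
    apply Subtype.ext
    simp
  map_mul' g h := by
    ext v : 1
    apply Multiplicative.toAdd.injective
    funext i
    apply Subtype.ext
    simp

/-- The semidirect product `∏ Λ_{s_i} / 2 ⋊ W(Ψ)`. -/
abbrev Semi (Ψ : Symbol ι) {m : ℕ} (s : Fin m → ι) : Type _ :=
  Multiplicative (Ψ.V s) ⋊[Ψ.act s] Ψ.W

/-- The vector `𝐮_i = (0, …, ū_{s_i}, …, 0)`, with the non-zero entry in position `i`. -/
def uvec (Ψ : Symbol ι) {m : ℕ} (s : Fin m → ι) (i : Fin m) : Ψ.V s :=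
  Pi.single i ⟨Ψ.ubar (s i), Ψ.ubar_mem_Lam (s i)⟩

/-- The values of `φ` on the generators: `s ↦ (0, s)` and `t_i ↦ (𝐮_i, 1)`. -/
def phiGen (Ψ : Symbol ι) {m : ℕ} (s : Fin m → ι) : ι ⊕ Fin m → Ψ.Semi s
  | .inl i => SemidirectProduct.inr (Ψ.cox.simple i)
  | .inr a => SemidirectProduct.inl (Multiplicative.ofAdd (Ψ.uvec s a))

theorem mul_self_V (Ψ : Symbol ι) {m : ℕ} (s : Fin m → ι) (v : Multiplicative (Ψ.V s)) :
    v * v = 1 := by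
  apply Multiplicative.toAdd.injective
  funext i
  apply Subtype.ext
  funext j
  simp [CharTwo.add_self_eq_zero]

theorem act_uvec (Ψ : Symbol ι) {m : ℕ} (s : Fin m → ι) (i : ι) (a : Fin m) (h : i ≠ s a) :
    Ψ.act s (Ψ.cox.simple i) (Multiplicative.ofAdd (Ψ.uvec s a)) =
      Multiplicative.ofAdd (Ψ.uvec s a) := by
  apply Multiplicative.toAdd.injective
  funext b
  apply Subtype.ext
  by_cases hb : b = a
  · subst hb
    simpa [act, uvec, rep_simple] using Ψ.reflection_ubar (s b) i h
  · simp [act, uvec, hb]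

theorem phi_liftable (Ψ : Symbol ι) {m : ℕ} (s : Fin m → ι) :
    (Ψ.extend s).IsLiftable (Ψ.phiGen s) := by
  have hi : ∀ i, Ψ.phiGen s (.inl i) * Ψ.phiGen s (.inl i) = 1 := fun i => by
    simp only [phiGen, ← map_mul]
    have := Ψ.cox.toCoxeterSystem.simple_mul_simple_self i
    rw [CoxeterMatrix.toCoxeterSystem_simple] at this
    rw [this, map_one]
  have hr : ∀ a, Ψ.phiGen s (.inr a) * Ψ.phiGen s (.inr a) = 1 := fun a => by
    simp only [phiGen, ← map_mul, mul_self_V, map_one]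
  have hrr : ∀ a b, (Ψ.phiGen s (.inr a) * Ψ.phiGen s (.inr b)) ^ 2 = 1 := fun a b => by
    simp only [phiGen, ← map_mul, pow_two, mul_self_V, map_one]
  have hc : ∀ i a, i ≠ s a →
      Ψ.phiGen s (.inl i) * Ψ.phiGen s (.inr a) = Ψ.phiGen s (.inr a) * Ψ.phiGen s (.inl i) :=
    fun i a h => by
      have e := SemidirectProduct.inl_aut (φ := Ψ.act s) (Ψ.cox.simple i)
        (Multiplicative.ofAdd (Ψ.uvec s a))
      rw [Ψ.act_uvec s i a h] at e
      simp only [phiGen]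
      conv_rhs => rw [e]
      simp
  have hfour : ∀ i a, (Ψ.phiGen s (.inl i) * Ψ.phiGen s (.inr a)) ^ 4 = 1 := fun i a => by
    have e : (Ψ.phiGen s (.inl i) * Ψ.phiGen s (.inr a)) ^ 2 = SemidirectProduct.inl
        (Ψ.act s (Ψ.cox.simple i) (Multiplicative.ofAdd (Ψ.uvec s a)) *
          Multiplicative.ofAdd (Ψ.uvec s a)) := by
      have h2 : (SemidirectProduct.inr (Ψ.cox.simple i) : Ψ.Semi s)⁻¹ =
          SemidirectProduct.inr (Ψ.cox.simple i) := inv_eq_of_mul_eq_one_left (hi i)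
      rw [map_mul, SemidirectProduct.inl_aut, map_inv, h2, pow_two]
      simp only [phiGen, mul_assoc]
    rw [show 4 = 2 * 2 from rfl, pow_mul, e, pow_two, ← map_mul, mul_self_V, map_one]
  have hflip : ∀ (x y : Ψ.Semi s) (k : ℕ), x * x = 1 → y * y = 1 → (x * y) ^ k = 1 →
      (y * x) ^ k = 1 := fun x y k hx hy h => by
    have : y * x = (x * y)⁻¹ := by
      rw [mul_inv_rev, inv_eq_of_mul_eq_one_left hx, inv_eq_of_mul_eq_one_left hy]
    rw [this, inv_pow, h, inv_one]
  have hmix : ∀ i a, (Ψ.phiGen s (.inl i) * Ψ.phiGen s (.inr a)) ^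
      (if i = s a then 4 else 2) = 1 := fun i a => by
    split_ifs with h
    · exact hfour i a
    · rw [(show Commute _ _ from hc i a h).mul_pow, pow_two, pow_two, hi, hr, one_mul]
  rintro (i | a) (j | b)
  · have := Ψ.cox.toCoxeterSystem.simple_mul_simple_pow i j
    rw [CoxeterMatrix.toCoxeterSystem_simple] at this
    simp only [extend, Matrix.of_apply, phiGen, ← map_mul, ← map_pow, this, map_one]
  · exact hmix i b
  · exact hflip _ _ _ (hi j) (hr a) (hmix j a)
  · change _ ^ (if a = b then 1 else 2) = _
    split_ifs with h
    · rw [h, pow_one, hr]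
    · exact hrr a b

/-- The homomorphism `φ : W(Γ) → ∏ Λ_{s_i} / 2 ⋊ W(Ψ)`. -/
def phi (Ψ : Symbol ι) {m : ℕ} (s : Fin m → ι) : (Ψ.extend s).Group →* Ψ.Semi s :=
  (Ψ.extend s).toCoxeterSystem.lift ⟨Ψ.phiGen s, Ψ.phi_liftable s⟩

/-- The indices `i` for which `(Ψ, s_i)` is not specially admissible; their number is `ℓ`. -/
abbrev NonSpecial (Ψ : Symbol ι) {m : ℕ} (s : Fin m → ι) : Type :=
  {i : Fin m // ¬ Ψ.SpeciallyAdmissible (s i)}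

/-- The values of `ε` on the generators: the coordinate of index `i` is `1` on `t_i` and `0` on
all other generators, so that it counts, modulo `2`, the occurrences of `t_i` in a word. -/
def epsGen (Ψ : Symbol ι) {m : ℕ} (s : Fin m → ι) :
    ι ⊕ Fin m → Multiplicative (Ψ.NonSpecial s → ZMod 2)
  | .inl _ => 1
  | .inr a => Multiplicative.ofAdd fun i => if (i : Fin m) = a then 1 else 0

theorem eps_liftable (Ψ : Symbol ι) {m : ℕ} (s : Fin m → ι) :
    (Ψ.extend s).IsLiftable (Ψ.epsGen s) := by
  have hsq : ∀ x : Multiplicative (Ψ.NonSpecial s → ZMod 2), x * x = 1 := fun x => by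
    apply Multiplicative.toAdd.injective
    funext i
    simp [CharTwo.add_self_eq_zero]
  have h2 : ∀ x : Multiplicative (Ψ.NonSpecial s → ZMod 2), x ^ 2 = 1 := fun x => by
    rw [pow_two, hsq]
  have h4 : ∀ x : Multiplicative (Ψ.NonSpecial s → ZMod 2), x ^ 4 = 1 := fun x => by
    rw [show 4 = 2 * 2 from rfl, pow_mul, h2]
  rintro (i | a) (j | b)
  · simp [epsGen]
  · change _ ^ (if i = s b then 4 else 2) = _
    split_ifs
    · exact h4 _
    · exact h2 _
  · change _ ^ (if j = s a then 4 else 2) = _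
    split_ifs
    · exact h4 _
    · exact h2 _
  · change _ ^ (if a = b then 1 else 2) = _
    split_ifs with h
    · rw [h, pow_one, hsq]
    · exact h2 _

/-- The homomorphism `ε : W(Γ) → (ℤ/2)^ℓ`. -/
def eps (Ψ : Symbol ι) {m : ℕ} (s : Fin m → ι) :
    (Ψ.extend s).Group →* Multiplicative (Ψ.NonSpecial s → ZMod 2) :=
  (Ψ.extend s).toCoxeterSystem.lift ⟨Ψ.epsGen s, Ψ.eps_liftable s⟩

/-- The group `(ℤ/2)^ℓ × (∏ Λ_{s_i} / 2 ⋊ W(Ψ))`. -/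
abbrev Target (Ψ : Symbol ι) {m : ℕ} (s : Fin m → ι) : Type _ :=
  Multiplicative (Ψ.NonSpecial s → ZMod 2) × Ψ.Semi s

/-- The homomorphism `φ̂ = ε × φ`. -/
def phiHat (Ψ : Symbol ι) {m : ℕ} (s : Fin m → ι) : (Ψ.extend s).Group →* Ψ.Target s :=
  (Ψ.eps s).prod (Ψ.phi s)

/-- The element `(𝐱, 𝐮, g)` of `(ℤ/2)^ℓ × (∏ Λ_{s_i} / 2 ⋊ W(Ψ))`. -/
def triple (Ψ : Symbol ι) {m : ℕ} (s : Fin m → ι) (x : Ψ.NonSpecial s → ZMod 2) (u : Ψ.V s)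
    (g : Ψ.W) : Ψ.Target s :=
  (Multiplicative.ofAdd x, ⟨Multiplicative.ofAdd u, g⟩)

end Symbol

/-- A subgroup is torsion free if it has no non-trivial element of finite order. -/
def TorsionFree {G : Type*} [Group G] (H : Subgroup G) : Prop :=
  ∀ g ∈ H, IsOfFinOrder g → g = 1

/-- The Coxeter element `s_1 ⋯ s_n` of `W(A_n)`. -/
def coxeterElementA (n : ℕ) : (typeA n).W :=
  (List.ofFn fun i : Fin n => (typeA n).cox.simple i).prod

/-- The Coxeter number `h` of `W(A_n)`: the order of its Coxeter elements. -/
def coxeterNumberA (n : ℕ) : ℕ := orderOf (coxeterElementA n)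

/-- The Coxeter element `s_2 s_3 s_4 s_5 s_6` of the visible subgroup
`W(D_5) = ⟨s_2, …, s_6⟩` of `W(E_6)`. -/
def coxeterElementD5 : typeE6.W :=
  typeE6.cox.simple 1 * typeE6.cox.simple 2 * typeE6.cox.simple 3 * typeE6.cox.simple 4 *
    typeE6.cox.simple 5

/-- The exponents of `W(E_6)`. -/
def exponentsE6 : List ℕ := [1, 4, 5, 7, 8, 11]

end WeylExt

end

/-! Write N = (u_s, u_s), which is even, and c = (u_s, x_s), which is odd when (Ψ, s) is admissible:
for the path with the single node s, independence says that ū_s and its reflection differ, and they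
differ by c times the class of x_s. Every element of W(Γ) is a product of conjugates w t_a w⁻¹, with
w in W(Ψ), followed by an element of W(Ψ). A conjugate is given a label: the element itself, the
index a and the vector w u_{s_a} of L. A W(Ψ)-equivariant assignment of involutions to labels
extends to a homomorphism from W(Γ) to a semidirect product as soon as a few of these involutions
commute; all information on torsion comes from two such homomorphisms and from one faithful integral
representation.

The kernel of φ̂ is torsion free. Let g in it have finite order, and consider the labels of a given
index that occur an odd number of times in g. A homomorphism into a product of infinite dihedral
groups shows that the vectors of any two of them have scalar product N - c²
(`form_vec_of_odd_count`). The sum of all these vectors vanishes in L/2. If their number is positive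
and even, the product of the sum with one of them is odd, which is absurd. If it is odd, the
coordinate of ε excludes it when s is not specially admissible; in the specially admissible case the
condition `NoOddRelation` does. Hence every label occurs an even number of times. In the faithful
integral representation the t_a are congruent to 1 modulo 2, so g is congruent to 1 modulo 4, and
finite order forces g = 1 (`eq_one_of_phiHat_eq_one`).

For ζ of order 2^(k+1), non-trivial torsion over ⟨ζ⟩ would give an involution above ζ^(2^k). The
labels that occur an odd number of times in an involution are permuted by its image in W(Ψ), so each
component of the image under φ lifts to a vector Y of L fixed by that image (`exists_fixed_lift`).
Since (v, v) modulo 4 depends only on the class of v in L/2, it suffices that all such fixed vectors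
have norm divisible by 4 while some component of ζ^(2^k) is the class of a y whose norm is not
(`torsionFree_comap_zpowers`). In A_n, with n + 1 = 2N, the half-turn of the coordinates works with
the root ε_0 - ε_N, of norm 2; in E_6 the fixed lattice of ξ⁴ has rank 2 and y, of norm 18, is the
sum of x_1 and its images under ξ, ξ², ξ³. The index follows from the surjectivity of φ̂ and from
|W(E_6)| = 51840. -/

noncomputable section

/-! ### Faithfulness of the representation attached to an integral Cartan matrix -/

namespace WeylExt

/-- An integral Cartan matrix for a Coxeter matrix whose off-diagonal labels are `2`, `3`, `4`. -/
structure IsCartan {B : Type*} (M : CoxeterMatrix B) (A : B → B → ℤ) : Prop where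
  diag : ∀ i, A i i = 2
  off : ∀ i j, i ≠ j → (M i j = 2 ∧ A i j = 0 ∧ A j i = 0) ∨ (M i j = 3 ∧ A i j = -1 ∧ A j i = -1) ∨
    (M i j = 4 ∧ A i j = -1 ∧ A j i = -2) ∨ (M i j = 4 ∧ A i j = -2 ∧ A j i = -1)

/-- The reflection `e_j ↦ e_j - A j i • e_i`. -/
def cartanReflection {B : Type*} [Fintype B] [DecidableEq B] (A : B → B → ℤ) (i : B) :
    Module.End ℤ (B → ℤ) :=
  LinearMap.id - (∑ j, A j i • LinearMap.proj j : (B → ℤ) →ₗ[ℤ] ℤ).smulRight (Pi.single i 1)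

section

variable {B : Type*} {M : CoxeterMatrix B}

@[simp] theorem simple_mul_self (M : CoxeterMatrix B) (i : B) : M.simple i * M.simple i = 1 :=
  M.toCoxeterSystem.simple_mul_simple_self i

@[simp] theorem simple_inv (M : CoxeterMatrix B) (i : B) : (M.simple i)⁻¹ = M.simple i :=
  inv_eq_of_mul_eq_one_left (simple_mul_self M i)

@[simp] theorem mul_simple_mul_simple (M : CoxeterMatrix B) (w : M.Group) (i : B) :
    w * M.simple i * M.simple i = w := by
  rw [mul_assoc, simple_mul_self, mul_one]

theorem braid_two (i j : B) (h : M i j = 2) :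
    M.toCoxeterSystem.simple i * M.toCoxeterSystem.simple j =
      M.toCoxeterSystem.simple j * M.toCoxeterSystem.simple i := by
  have := M.toCoxeterSystem.simple_mul_simple_pow i j
  rw [h] at this
  have h' := eq_inv_of_mul_eq_one_left ((pow_two _).symm.trans this)
  simpa using h'

theorem braid_three (i j : B) (h : M i j = 3) :
    M.toCoxeterSystem.simple i * M.toCoxeterSystem.simple j * M.toCoxeterSystem.simple i =
      M.toCoxeterSystem.simple j * M.toCoxeterSystem.simple i * M.toCoxeterSystem.simple j := by
  have := M.toCoxeterSystem.simple_mul_simple_pow i j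
  rw [h] at this
  have h' := eq_inv_of_mul_eq_one_left
    (a := M.toCoxeterSystem.simple i * M.toCoxeterSystem.simple j * M.toCoxeterSystem.simple i)
    (b := M.toCoxeterSystem.simple j * M.toCoxeterSystem.simple i * M.toCoxeterSystem.simple j)
    (by simpa [pow_succ, mul_assoc] using this)
  simpa [mul_assoc] using h'

theorem braid_four (i j : B) (h : M i j = 4) :
    M.toCoxeterSystem.simple i * M.toCoxeterSystem.simple j *
      (M.toCoxeterSystem.simple i * M.toCoxeterSystem.simple j) =
      M.toCoxeterSystem.simple j * M.toCoxeterSystem.simple i *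
      (M.toCoxeterSystem.simple j * M.toCoxeterSystem.simple i) := by
  have := M.toCoxeterSystem.simple_mul_simple_pow i j
  rw [h] at this
  have h' := eq_inv_of_mul_eq_one_left
    (a := M.toCoxeterSystem.simple i * M.toCoxeterSystem.simple j *
      (M.toCoxeterSystem.simple i * M.toCoxeterSystem.simple j))
    (b := M.toCoxeterSystem.simple i * M.toCoxeterSystem.simple j *
      (M.toCoxeterSystem.simple i * M.toCoxeterSystem.simple j))
    (by simpa [pow_succ, mul_assoc] using this)
  simpa [mul_assoc] using h'

end

section

variable {B : Type*} [Fintype B] [DecidableEq B] {M : CoxeterMatrix B} {A : B → B → ℤ}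

theorem cartanReflection_apply (A : B → B → ℤ) (i : B) (v : B → ℤ) :
    cartanReflection A i v = v - (∑ j, v j * A j i) • Pi.single i 1 := by
  simp [cartanReflection, mul_comm]

theorem cartanReflection_single (A : B → B → ℤ) (i j : B) :
    cartanReflection A i (Pi.single j 1) = Pi.single j 1 - A j i • Pi.single i 1 := by
  simp [cartanReflection_apply, Pi.single_apply]

/-- Both reflections change a vector only along the two simple roots, through the two linear forms
`f` and `g`, so each relation is an identity that depends only on a 2 × 2 block of the Cartan
matrix. -/
theorem cartanReflection_liftable (hA : IsCartan M A) : M.IsLiftable (cartanReflection A) := by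
  have key : ∀ i j : B, ∀ v : B → ℤ, cartanReflection A i v =
      v - (∑ j, A j i • LinearMap.proj j : (B → ℤ) →ₗ[ℤ] ℤ) v • Pi.single i 1 := by
    intro i j v
    simp [cartanReflection]
  intro i j
  set f : (B → ℤ) →ₗ[ℤ] ℤ := ∑ k, A k i • LinearMap.proj k with hf
  set g : (B → ℤ) →ₗ[ℤ] ℤ := ∑ k, A k j • LinearMap.proj k with hg
  have hi : ∀ v, cartanReflection A i v = v - f v • Pi.single i 1 := fun v => key i j v
  have hj : ∀ v, cartanReflection A j v = v - g v • Pi.single j 1 := fun v => key j i v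
  have fi : f (Pi.single i 1) = 2 := by simp [hf, Pi.single_apply, hA.diag]
  have gj : g (Pi.single j 1) = 2 := by simp [hg, Pi.single_apply, hA.diag]
  have fj : f (Pi.single j 1) = A j i := by simp [hf, Pi.single_apply]
  have gi : g (Pi.single i 1) = A i j := by simp [hg, Pi.single_apply]
  by_cases hij : i = j
  · subst hij
    rw [M.diagonal, pow_one]
    refine LinearMap.ext fun v => ?_
    simp only [Module.End.mul_apply, hi, map_sub, map_smul, fi, Module.End.one_apply, smul_eq_mul]
    module
  · rcases hA.off i j hij with ⟨h, h1, h2⟩ | ⟨h, h1, h2⟩ | ⟨h, h1, h2⟩ | ⟨h, h1, h2⟩ <;>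
    · rw [h]
      rw [h1] at gi
      rw [h2] at fj
      refine LinearMap.ext fun v => ?_
      simp only [pow_succ, pow_zero, one_mul, Module.End.mul_apply, hi, hj, map_sub, map_smul, fi,
        fj, gi, gj, Module.End.one_apply, smul_eq_mul]
      module

/-- The representation of a Coxeter group attached to an integral Cartan matrix. -/
def cartanRep (hA : IsCartan M A) : M.Group →* Module.End ℤ (B → ℤ) :=
  M.toCoxeterSystem.lift ⟨cartanReflection A, cartanReflection_liftable hA⟩

theorem cartanRep_simple (hA : IsCartan M A) (i : B) :
    cartanRep hA (M.toCoxeterSystem.simple i) = cartanReflection A i :=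
  M.toCoxeterSystem.lift_apply_simple _ i

local notation "cs" => CoxeterMatrix.toCoxeterSystem

/-- A simple root stays positive under every element that it does not shorten. -/
theorem cartanRep_single_nonneg (hA : IsCartan M A) (w : M.Group) (i : B)
    (hw : ¬ (cs M).IsRightDescent w i) : 0 ≤ cartanRep hA w (Pi.single i 1) := by
  induction hn : (cs M).length w using Nat.strong_induction_on generalizing w i with
  | _ n ih =>
  have ih' : ∀ (v : M.Group) (k : B), (cs M).length v < (cs M).length w →
      ¬ (cs M).IsRightDescent v k → 0 ≤ cartanRep hA v (Pi.single k 1) :=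
    fun v k hv hk => ih _ (hn ▸ hv) v k hk rfl
  by_cases h1 : w = 1
  · subst h1
    simp
  obtain ⟨j, hj⟩ := (cs M).exists_rightDescent_of_ne_one h1
  have hij : i ≠ j := fun h => hw (h ▸ hj)
  have step : ∀ (v : M.Group) (k : B), (cs M).IsRightDescent v k →
      ∃ v', v = v' * (cs M).simple k ∧ (cs M).length v' + 1 = (cs M).length v ∧
        ¬ (cs M).IsRightDescent v' k := by
    intro v k hk
    refine ⟨v * (cs M).simple k, by simp, (cs M).isRightDescent_iff.1 hk, ?_⟩
    exact (cs M).isRightDescent_iff_not_isRightDescent_mul.1 hk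
  have ri : ∀ v, cartanRep hA (v * (cs M).simple i) = cartanRep hA v * cartanReflection A i :=
    fun v => by rw [map_mul, cartanRep_simple]
  have rj : ∀ v, cartanRep hA (v * (cs M).simple j) = cartanRep hA v * cartanReflection A j :=
    fun v => by rw [map_mul, cartanRep_simple]
  have short : ∀ (v : M.Group), w * (cs M).simple i = v → (cs M).length w ≤ (cs M).length v := by
    rintro v rfl
    exact not_lt.1 hw
  have len1 := fun (v : M.Group) (k : B) => (cs M).length_mul_simple v k
  obtain ⟨v1, hv1, hl1, hd1⟩ := step w j hj
  have p1 := ih' v1 j (by omega) hd1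
  -- The letters `j`, `i`, `j` are stripped from the right of `w` as long as they are descents. When
  -- this stops, the image of the root of `i` is a nonnegative combination of images of simple roots
  -- that stay positive under what is left. A run of full length `M i j` is impossible: by the braid
  -- relation `w` could be rewritten so as to end in `i`.
  by_cases hs1 : (cs M).IsRightDescent v1 i
  swap
  · have q1 := ih' v1 i (by omega) hs1
    have : A i j ≤ 0 := by
      rcases hA.off i j hij with h | h | h | h <;> omega
    rw [hv1, rj, Module.End.mul_apply, cartanReflection_single, map_sub, map_smul]
    have := smul_nonneg (neg_nonneg.2 this) p1
    rw [neg_smul] at this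
    rw [sub_eq_add_neg]
    exact add_nonneg q1 this
  obtain ⟨v2, hv2, hl2, hd2⟩ := step v1 i hs1
  have p2 := ih' v2 i (by omega) hd2
  have h2 : M i j ≠ 2 := fun h => by
    have := short (v2 * (cs M).simple j) (by
      rw [hv1, hv2, mul_assoc, mul_assoc, ← mul_assoc ((cs M).simple i), braid_two i j h]
      simp)
    have := len1 v2 j
    omega
  have wv2 : cartanRep hA w (Pi.single i 1) = cartanRep hA v2 ((A i j * A j i - 1) • Pi.single i 1) +
      cartanRep hA v2 ((- A i j) • Pi.single j 1) := by
    rw [hv1, rj, hv2, ri, Module.End.mul_apply, cartanReflection_single, Module.End.mul_apply,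
      ← map_add]
    congr 1
    rw [map_sub, map_smul, cartanReflection_single, cartanReflection_single, hA.diag]
    module
  by_cases hs2 : (cs M).IsRightDescent v2 j
  swap
  · have q2 := ih' v2 j (by omega) hs2
    rw [wv2, map_smul, map_smul]
    refine add_nonneg (smul_nonneg ?_ p2) (smul_nonneg ?_ q2) <;>
    · rcases hA.off i j hij with ⟨h, h1, h2⟩ | ⟨h, h1, h2⟩ | ⟨h, h1, h2⟩ | ⟨h, h1, h2⟩ <;>
        simp_all
  obtain ⟨v3, hv3, hl3, hd3⟩ := step v2 j hs2
  have p3 := ih' v3 j (by omega) hd3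
  have h3 : M i j ≠ 3 := fun h => by
    have := short (v3 * (cs M).simple i * (cs M).simple j) (by
      rw [hv1, hv2, hv3]
      have := braid_three i j h
      calc _ = v3 * ((cs M).simple j * (cs M).simple i * (cs M).simple j) * (cs M).simple i := by
            simp only [mul_assoc]
        _ = _ := by rw [← this]; simp [mul_assoc])
    have := len1 v3 i
    have := len1 (v3 * (cs M).simple i) j
    omega
  have hab : A i j * A j i = 2 := by
    rcases hA.off i j hij with ⟨h, h1, h2⟩ | ⟨h, h1, h2⟩ | ⟨h, h1, h2⟩ | ⟨h, h1, h2⟩ <;> simp_all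
  have hM : M i j = 4 := by
    rcases hA.off i j hij with ⟨h, h1, h2⟩ | ⟨h, h1, h2⟩ | ⟨h, h1, h2⟩ | ⟨h, h1, h2⟩ <;> simp_all
  have hs3 : ¬ (cs M).IsRightDescent v3 i := fun hs3 => by
    obtain ⟨v4, hv4, hl4, hd4⟩ := step v3 i hs3
    have := short (v4 * (cs M).simple j * (cs M).simple i * (cs M).simple j) (by
      rw [hv1, hv2, hv3, hv4]
      have := braid_four i j hM
      calc _ = v4 * ((cs M).simple i * (cs M).simple j * ((cs M).simple i * (cs M).simple j)) *
            (cs M).simple i := by simp only [mul_assoc]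
        _ = _ := by rw [this]; simp [mul_assoc])
    have := len1 v4 j
    have := len1 (v4 * (cs M).simple j) i
    have := len1 (v4 * (cs M).simple j * (cs M).simple i) j
    omega
  have q3 := ih' v3 i (by omega) hs3
  -- For the label 4 the word `j * i * j` fixes the root of `i`, because the product of the two
  -- off-diagonal entries is 2.
  have : cartanRep hA w (Pi.single i 1) = cartanRep hA v3 (Pi.single i 1) := by
    rw [wv2, ← map_add, hab, hv3, rj, Module.End.mul_apply]
    congr 1
    rw [map_add, map_smul, map_smul, cartanReflection_single, cartanReflection_single, hA.diag]
    module
  rw [this]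
  exact q3

theorem cartanRep_single_nonpos (hA : IsCartan M A) (w : M.Group) (i : B)
    (hw : (cs M).IsRightDescent w i) : cartanRep hA w (Pi.single i 1) ≤ 0 := by
  have h := cartanRep_single_nonneg hA (w * (cs M).simple i) i
    ((cs M).isRightDescent_iff_not_isRightDescent_mul.1 hw)
  rw [map_mul, cartanRep_simple, Module.End.mul_apply, cartanReflection_single, hA.diag, map_sub,
    map_smul, two_smul, sub_add_cancel_left] at h
  exact neg_nonneg.1 h

/-- An element other than 1 has a right descent, whose simple root it makes nonpositive and hence
cannot fix. -/
theorem cartanRep_injective (hA : IsCartan M A) : Function.Injective (cartanRep hA) := by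
  rw [injective_iff_map_eq_one]
  intro w hw
  by_contra h1
  obtain ⟨i, hi⟩ := (cs M).exists_rightDescent_of_ne_one h1
  have := cartanRep_single_nonpos hA w i hi i
  rw [hw] at this
  simp at this

end

end WeylExt

end

noncomputable section

namespace WeylExt

/-! ### Integral endomorphisms of finite order -/

section

variable {B : Type*}

/-- A vector v of the kernel satisfies v = -2 R v; iterating, it is divisible by every power of 2.
-/
theorem injective_one_add_two_smul (R : Module.End ℤ (B → ℤ)) :
    Function.Injective (1 + (2 : ℤ) • R : Module.End ℤ (B → ℤ)) := by
  rw [injective_iff_map_eq_zero]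
  intro v hv
  have hv' : v = (2 : ℤ) • (-R v) := by
    have : v + (2 : ℤ) • R v = 0 := by simpa using hv
    rw [smul_neg]
    exact eq_neg_of_add_eq_zero_left this
  have key : ∀ k : ℕ, ∃ x, v = (2 : ℤ) ^ k • x := by
    intro k
    induction k with
    | zero => exact ⟨v, by simp⟩
    | succ k ih =>
      obtain ⟨x, hx⟩ := ih
      refine ⟨-R x, ?_⟩
      rw [hv', hx, map_smul]
      module
  funext b
  by_contra hb
  obtain ⟨x, hx⟩ := key (v b).natAbs
  have h1 : (2 : ℤ) ^ (v b).natAbs ∣ v b := ⟨x b, congrFun hx b⟩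
  have h2 := Int.natAbs_dvd_natAbs.2 h1
  rw [Int.natAbs_pow] at h2
  have h3 := Nat.le_of_dvd (Int.natAbs_pos.2 hb) h2
  have h4 : (v b).natAbs < 2 ^ (v b).natAbs := Nat.lt_two_pow_self
  exact absurd h3 (not_le.2 h4)

theorem exists_pow_eq_one_add_four_smul (R : Module.End ℤ (B → ℤ)) (n : ℕ) :
    ∃ R', (1 + (4 : ℤ) • R) ^ n = 1 + (4 : ℤ) • R' := by
  induction n with
  | zero => exact ⟨0, by simp⟩
  | succ n ih =>
    obtain ⟨R', h⟩ := ih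
    refine ⟨R' + R + (4 : ℤ) • (R' * R), ?_⟩
    rw [pow_succ, h]
    simp only [mul_add, add_mul, mul_one, one_mul, smul_mul_assoc, mul_smul_comm]
    module

/-- An integral endomorphism of finite order that is congruent to `1` modulo `4` is trivial. -/
theorem eq_one_of_isOfFinOrder_of_congr (A R : Module.End ℤ (B → ℤ)) (hA : A = 1 + (4 : ℤ) • R)
    (n : ℕ) (hn : 0 < n) (h : A ^ n = 1) : A = 1 := by
  induction n using Nat.strong_induction_on generalizing A R with
  | _ n ih =>
  -- For odd `k` this sum is congruent to 1 modulo 2, hence injective, which settles odd exponents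
  -- by the geometric sum.
  have hsum : ∀ k : ℕ, ∃ Q, ∑ i ∈ Finset.range k, A ^ i = (k : ℤ) • 1 + (4 : ℤ) • Q := by
    intro k
    induction k with
    | zero => exact ⟨0, by simp⟩
    | succ k ihk =>
      obtain ⟨Q, hQ⟩ := ihk
      obtain ⟨R', hR'⟩ := exists_pow_eq_one_add_four_smul R k
      refine ⟨Q + R', ?_⟩
      rw [Finset.sum_range_succ, hQ, hA, hR']
      push_cast
      module
  have cancel : ∀ C : Module.End ℤ (B → ℤ), Function.Injective C → C * (A - 1) = 0 → A = 1 := by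
    intro C hC h0
    refine sub_eq_zero.1 (LinearMap.ext fun v => hC ?_)
    have := LinearMap.congr_fun h0 v
    simpa using this
  rcases Nat.even_or_odd' n with ⟨k, rfl | rfl⟩
  -- For the exponent 2k: in (A^k + 1)(A^k - 1) = 0 the first factor is twice an endomorphism
  -- congruent to 1 modulo 2, so A^k = 1. The congruence modulo 4, not only modulo 2, is what makes
  -- this work.
  · have hk : 0 < k := by omega
    obtain ⟨R', hR'⟩ := exists_pow_eq_one_add_four_smul R k
    rw [← hA] at hR'
    refine ih k (by omega) A R hA hk ?_
    have h2 : (1 + (2 : ℤ) • R' : Module.End ℤ (B → ℤ)) * (A ^ k - 1) = 0 := by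
      have h3 : (A ^ k + 1) * (A ^ k - 1) = 0 := by
        rw [add_mul, mul_sub, ← pow_add, ← two_mul, h]
        simp
      have h4 : A ^ k + 1 = (2 : ℤ) • (1 + (2 : ℤ) • R') := by
        rw [hR']
        module
      rw [h4, smul_mul_assoc] at h3
      exact (smul_eq_zero.1 h3).resolve_left (by norm_num)
    refine sub_eq_zero.1 (LinearMap.ext fun v => injective_one_add_two_smul R' ?_)
    have := LinearMap.congr_fun h2 v
    simpa using this
  · obtain ⟨Q, hQ⟩ := hsum (2 * k + 1)
    refine cancel (∑ i ∈ Finset.range (2 * k + 1), A ^ i) ?_ ?_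
    · have : ∑ i ∈ Finset.range (2 * k + 1), A ^ i =
          1 + (2 : ℤ) • ((k : ℤ) • (1 : Module.End ℤ (B → ℤ)) + (2 : ℤ) • Q) := by
        rw [hQ]
        push_cast
        module
      rw [this]
      exact injective_one_add_two_smul _
    · rw [geom_sum_mul, h, sub_self]

/-- A product of endomorphisms `1 - 2 P`, to the second order. -/
theorem exists_prod_eq_one_sub_add {X : Type*} (f P : X → Module.End ℤ (B → ℤ)) (l : List X)
    (h : ∀ x ∈ l, f x = 1 - (2 : ℤ) • P x) :
    ∃ R, (l.map f).prod = 1 - (2 : ℤ) • (l.map P).sum + (4 : ℤ) • R := by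
  induction l with
  | nil => exact ⟨0, by simp⟩
  | cons a l ih =>
    obtain ⟨R, hR⟩ := ih fun x hx => h x (List.mem_cons_of_mem _ hx)
    refine ⟨R + P a * (l.map P).sum - (2 : ℤ) • (P a * R), ?_⟩
    rw [List.map_cons, List.prod_cons, hR, h a List.mem_cons_self, List.map_cons, List.sum_cons]
    simp only [sub_mul, mul_add, mul_sub, one_mul, mul_one, smul_mul_assoc, mul_smul_comm]
    module

end

/-! ### The faithful integral representation of `W(Γ)` -/

namespace Symbol

variable {ι : Type*} [Fintype ι] [DecidableEq ι]

/-- An integral Cartan matrix for `Γ`. -/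
def extendCartan (Ψ : Symbol ι) {m : ℕ} (s : Fin m → ι) : ι ⊕ Fin m → ι ⊕ Fin m → ℤ
  | .inl i, .inl j => cartan Ψ.cox i j
  | .inl i, .inr b => if i = s b then -2 else 0
  | .inr a, .inl j => if j = s a then -1 else 0
  | .inr a, .inr b => if a = b then 2 else 0

theorem isCartan_cartan (Ψ : Symbol ι) : IsCartan Ψ.cox (cartan Ψ.cox) where
  diag := cartan_self Ψ.cox
  off i j h := by
    have h' : j ≠ i := h.symm
    rcases Ψ.simplyLaced i j with h1 | h2 | h3
    · exact absurd h1 (Ψ.cox.off_diagonal i j h)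
    · have : Ψ.cox j i = 2 := by rw [Ψ.cox.symmetric, h2]
      simp [cartan, h, h', h2, this]
    · have : Ψ.cox j i = 3 := by rw [Ψ.cox.symmetric, h3]
      simp [cartan, h, h', h3, this]

theorem isCartan_extendCartan (Ψ : Symbol ι) {m : ℕ} (s : Fin m → ι) :
    IsCartan (Ψ.extend s) (Ψ.extendCartan s) where
  diag := by
    rintro (i | a)
    · exact cartan_self Ψ.cox i
    · simp [extendCartan]
  off := by
    rintro (i | a) (j | b) h
    · exact Ψ.isCartan_cartan.off i j fun h' => h (by rw [h'])
    · by_cases hi : i = s b <;> simp [extend, extendCartan, hi]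
    · by_cases hi : j = s a <;> simp [extend, extendCartan, hi]
    · have hab : a ≠ b := fun h' => h (by rw [h'])
      simp [extend, extendCartan, hab, hab.symm]

/-- The faithful representation of `W(Γ)` on the root lattice spanned by all nodes. -/
def extendRep (Ψ : Symbol ι) {m : ℕ} (s : Fin m → ι) :
    (Ψ.extend s).Group →* Module.End ℤ (ι ⊕ Fin m → ℤ) :=
  cartanRep (Ψ.isCartan_extendCartan s)

theorem extendRep_injective (Ψ : Symbol ι) {m : ℕ} (s : Fin m → ι) :
    Function.Injective (Ψ.extendRep s) :=
  cartanRep_injective _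

/-- The edges labelled 4 are oriented in `extendCartan` so that the column of a new node, which
defines its reflection, has the even entries 2, -2 and 0 only. The new generators are therefore
trivial modulo 2. -/
theorem exists_extendRep_simple_inr (Ψ : Symbol ι) {m : ℕ} (s : Fin m → ι) (a : Fin m) :
    ∃ P, Ψ.extendRep s ((Ψ.extend s).simple (.inr a)) = 1 - (2 : ℤ) • P := by
  let f : (ι ⊕ Fin m → ℤ) →ₗ[ℤ] ℤ :=
    LinearMap.proj (R := ℤ) (φ := fun _ => ℤ) (Sum.inr a) - LinearMap.proj (Sum.inl (s a))
  refine ⟨f.smulRight (Pi.single (.inr a) 1), ?_⟩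
  rw [extendRep, ← CoxeterMatrix.toCoxeterSystem_simple, cartanRep_simple]
  refine LinearMap.ext fun v => ?_
  rw [cartanReflection_apply]
  have : ∑ j, v j * Ψ.extendCartan s j (.inr a) = 2 * (v (.inr a) - v (.inl (s a))) := by
    simp [Fintype.sum_sum_type, extendCartan]
    ring
  rw [this]
  simp [f, mul_smul]

end Symbol

end WeylExt

end

noncomputable section

namespace WeylExt

/-! ### Reduction of the root lattice modulo 2 -/

namespace Symbol

section

variable {ι : Type*}

theorem exists_eq_two_smul_of_red_eq_zero {v : ι → ℤ} (h : red v = 0) :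
    ∃ w : ι → ℤ, v = (2 : ℤ) • w := by
  have h2 : ∀ i, ∃ k, v i = 2 * k := fun i =>
    (ZMod.intCast_zmod_eq_zero_iff_dvd (v i) 2).1 (congrFun h i)
  choose w hw using h2
  exact ⟨w, funext fun i => by simp [hw]⟩

theorem red_add (v w : ι → ℤ) : red (v + w) = red v + red w := by
  funext i
  simp [red]

theorem red_sub (v w : ι → ℤ) : red (v - w) = red v - red w := by
  funext i
  simp [red]

theorem red_zero : red (0 : ι → ℤ) = 0 := by
  funext i
  simp [red]

end

variable {ι : Type*} [Fintype ι] [DecidableEq ι]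

/-! ### The integral form -/

/-- The integral symmetric form on the root lattice. -/
def form (Ψ : Symbol ι) : LinearMap.BilinForm ℤ (ι → ℤ) :=
  Matrix.toBilin' (Matrix.of (cartan Ψ.cox))

theorem form_single_right (Ψ : Symbol ι) (v : ι → ℤ) (t : ι) :
    Ψ.form v (Pi.single t 1) = pairing ℤ Ψ.cox t v := by
  simp [form, Matrix.toBilin'_apply, pairing, Pi.single_apply]

theorem form_comm (Ψ : Symbol ι) (v w : ι → ℤ) : Ψ.form v w = Ψ.form w v := by
  simp only [form, Matrix.toBilin'_apply, Matrix.of_apply]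
  rw [Finset.sum_comm]
  refine Finset.sum_congr rfl fun i _ => Finset.sum_congr rfl fun j _ => ?_
  rw [cartan_symm]
  ring

theorem form_reflection (Ψ : Symbol ι) (t : ι) (v w : ι → ℤ) :
    Ψ.form (reflection ℤ Ψ.cox t v) (reflection ℤ Ψ.cox t w) = Ψ.form v w := by
  simp only [reflection_apply, map_sub, map_smul, LinearMap.sub_apply, LinearMap.smul_apply,
    form_single_right, pairing_single, cartan_self, Ψ.form_comm (Pi.single t 1) w, smul_eq_mul]
  push_cast
  ring

theorem form_rep (Ψ : Symbol ι) (g : Ψ.W) (v w : ι → ℤ) :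
    Ψ.form (Ψ.rep ℤ g v) (Ψ.rep ℤ g w) = Ψ.form v w := by
  induction g using Ψ.cox.toCoxeterSystem.simple_induction_left generalizing v w with
  | one => simp
  | mul_simple_left g i ih =>
    rw [CoxeterMatrix.toCoxeterSystem_simple, map_mul, Module.End.mul_apply, Module.End.mul_apply,
      rep_simple, form_reflection, ih]

/-- The diagonal entries are 2 and the off-diagonal terms occur in equal pairs. -/
theorem even_form_self (Ψ : Symbol ι) (v : ι → ℤ) : Even (Ψ.form v v) := by
  have key : ∀ S : Finset ι, Even (Ψ.form (∑ i ∈ S, v i • Pi.single i 1)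
      (∑ i ∈ S, v i • Pi.single i 1)) := by
    intro S
    induction S using Finset.induction_on with
    | empty => simp
    | insert a S ha ih =>
      rw [Finset.sum_insert ha]
      generalize ∑ i ∈ S, v i • (Pi.single i 1 : ι → ℤ) = z at ih
      simp only [map_add, LinearMap.add_apply, map_smul, LinearMap.smul_apply, form_single_right,
        pairing_single, cartan_self, Ψ.form_comm (Pi.single a 1) z, smul_eq_mul]
      obtain ⟨k, hk⟩ := ih
      rw [hk]
      exact ⟨v a * v a + v a * pairing ℤ Ψ.cox a z + k, by push_cast; ring⟩
  have hv : ∑ i, v i • (Pi.single i 1 : ι → ℤ) = v := (pi_eq_sum_univ' v).symm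
  have h := key Finset.univ
  rwa [hv] at h

/-- The quadratic form `(v, v) / 2` is defined modulo `2` on `L / 2L`. -/
theorem form_self_congr (Ψ : Symbol ι) {v w : ι → ℤ} (h : red v = red w) :
    (4 : ℤ) ∣ Ψ.form v v - Ψ.form w w := by
  obtain ⟨z, hz⟩ := exists_eq_two_smul_of_red_eq_zero (v := v - w) (by rw [red_sub, h, sub_self])
  obtain rfl : v = w + (2 : ℤ) • z := by rw [← hz]; abel
  refine ⟨Ψ.form w z + Ψ.form z z, ?_⟩
  simp only [map_add, LinearMap.add_apply, map_smul, LinearMap.smul_apply, Ψ.form_comm z w,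
    smul_eq_mul]
  ring

/-! ### Homomorphisms from `W(Γ)` to semidirect products -/

/-- The inclusion of `W(Ψ)` in `W(Γ)`. -/
def incl (Ψ : Symbol ι) {m : ℕ} (s : Fin m → ι) : Ψ.W →* (Ψ.extend s).Group :=
  Ψ.cox.toCoxeterSystem.lift ⟨fun i => (Ψ.extend s).simple (.inl i), fun i j => by
    have := (Ψ.extend s).toCoxeterSystem.simple_mul_simple_pow (.inl i) (.inl j)
    rw [CoxeterMatrix.toCoxeterSystem_simple] at this
    exact this⟩

theorem incl_simple (Ψ : Symbol ι) {m : ℕ} (s : Fin m → ι) (i : ι) :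
    Ψ.incl s (Ψ.cox.simple i) = (Ψ.extend s).simple (.inl i) :=
  Ψ.cox.toCoxeterSystem.lift_apply_simple _ i

section SemiLift

variable (Ψ : Symbol ι) {m : ℕ} (s : Fin m → ι) {N : Type*} [Group N] (α : Ψ.W →* MulAut N)
  (τ : Fin m → N)

/-- Values on the generators of `W(Γ)` in a semidirect product by `W(Ψ)`. -/
def semiGen : ι ⊕ Fin m → N ⋊[α] Ψ.W
  | .inl i => SemidirectProduct.inr (Ψ.cox.simple i)
  | .inr a => SemidirectProduct.inl (τ a)

/-- The hypotheses are the relations of Γ that involve new nodes. In particular (s t)² = (s t s) t,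
so for involutions (s t)⁴ = 1 amounts to t commuting with its conjugate by s. -/
theorem semiGen_liftable (hsq : ∀ a, τ a * τ a = 1) (hcomm : ∀ a b, Commute (τ a) (τ b))
    (hfix : ∀ i a, i ≠ s a → α (Ψ.cox.simple i) (τ a) = τ a)
    (hmove : ∀ a, Commute (α (Ψ.cox.simple (s a)) (τ a)) (τ a)) :
    (Ψ.extend s).IsLiftable (Ψ.semiGen α τ) := by
  have hi : ∀ i, Ψ.semiGen α τ (.inl i) * Ψ.semiGen α τ (.inl i) = 1 := fun i => by
    simp only [semiGen, ← map_mul, simple_mul_self, map_one]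
  have hr : ∀ a, Ψ.semiGen α τ (.inr a) * Ψ.semiGen α τ (.inr a) = 1 := fun a => by
    simp only [semiGen, ← map_mul, hsq, map_one]
  have hconj : ∀ i a, Ψ.semiGen α τ (.inl i) * Ψ.semiGen α τ (.inr a) * Ψ.semiGen α τ (.inl i) =
      SemidirectProduct.inl (α (Ψ.cox.simple i) (τ a)) := fun i a => by
    have h := inv_eq_of_mul_eq_one_left (hi i)
    simp only [semiGen] at h ⊢
    rw [SemidirectProduct.inl_aut, map_inv, h]
  have hfour : ∀ i a, (Ψ.semiGen α τ (.inl i) * Ψ.semiGen α τ (.inr a)) ^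
      (if i = s a then 4 else 2) = 1 := fun i a => by
    have e : (Ψ.semiGen α τ (.inl i) * Ψ.semiGen α τ (.inr a)) ^ 2 =
        SemidirectProduct.inl (α (Ψ.cox.simple i) (τ a) * τ a) := by
      rw [map_mul, ← hconj, pow_two]
      simp only [semiGen, mul_assoc]
    split_ifs with h
    · subst h
      rw [show 4 = 2 * 2 from rfl, pow_mul, e, ← map_pow, (hmove a).mul_pow, pow_two, pow_two,
        ← map_mul, hsq, map_one, one_mul, map_one]
    · rw [e, hfix i a h, hsq, map_one]
  have hflip : ∀ (x y : N ⋊[α] Ψ.W) (k : ℕ), x * x = 1 → y * y = 1 → (x * y) ^ k = 1 →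
      (y * x) ^ k = 1 := fun x y k hx hy h => by
    have : y * x = (x * y)⁻¹ := by
      rw [mul_inv_rev, inv_eq_of_mul_eq_one_left hx, inv_eq_of_mul_eq_one_left hy]
    rw [this, inv_pow, h, inv_one]
  rintro (i | a) (j | b)
  · have := Ψ.cox.toCoxeterSystem.simple_mul_simple_pow i j
    rw [CoxeterMatrix.toCoxeterSystem_simple] at this
    simp only [extend, Matrix.of_apply, semiGen, ← map_mul, ← map_pow, this, map_one]
  · exact hfour i b
  · exact hflip _ _ _ (hi j) (hr a) (hfour j a)
  · change _ ^ (if a = b then 1 else 2) = _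
    split_ifs with h
    · rw [h, pow_one, hr]
    · simp only [semiGen]
      rw [← map_mul, ← map_pow, (hcomm a b).mul_pow, pow_two, pow_two, hsq, hsq, one_mul, map_one]

end SemiLift

/-- The element of `W(Γ)` with a given decomposition into conjugates of the new generators and an
element of `W(Ψ)`. -/
def ofConjugates (Ψ : Symbol ι) {m : ℕ} (s : Fin m → ι) (l : List (Ψ.W × Fin m)) (w : Ψ.W) :
    (Ψ.extend s).Group :=
  (l.map fun p => Ψ.incl s p.1 * (Ψ.extend s).simple (.inr p.2) * (Ψ.incl s p.1)⁻¹).prod *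
    Ψ.incl s w

theorem exists_eq_ofConjugates (Ψ : Symbol ι) {m : ℕ} (s : Fin m → ι) (g : (Ψ.extend s).Group) :
    ∃ l w, g = Ψ.ofConjugates s l w := by
  induction g using (Ψ.extend s).toCoxeterSystem.simple_induction_left with
  | one => exact ⟨[], 1, by simp [ofConjugates]⟩
  | mul_simple_left g k ih =>
    obtain ⟨l, w, rfl⟩ := ih
    rw [CoxeterMatrix.toCoxeterSystem_simple]
    rcases k with i | a
    -- A generator of W(Ψ) is moved to the right past the conjugates, each of which it conjugates.
    · refine ⟨l.map fun p => (Ψ.cox.simple i * p.1, p.2), Ψ.cox.simple i * w, ?_⟩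
      have : ∀ l : List (Ψ.W × Fin m), ((l.map fun p => (Ψ.cox.simple i * p.1, p.2)).map fun p =>
          Ψ.incl s p.1 * (Ψ.extend s).simple (.inr p.2) * (Ψ.incl s p.1)⁻¹).prod =
          (Ψ.extend s).simple (.inl i) * (l.map fun p =>
          Ψ.incl s p.1 * (Ψ.extend s).simple (.inr p.2) * (Ψ.incl s p.1)⁻¹).prod *
          (Ψ.extend s).simple (.inl i) := by
        intro l
        induction l with
        | nil => simp
        | cons p l ih =>
          rw [List.map_cons, List.map_cons, List.prod_cons, ih, List.map_cons, List.prod_cons]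
          simp only [map_mul, incl_simple, mul_inv_rev, simple_inv, ← mul_assoc,
            mul_simple_mul_simple]
      rw [ofConjugates, ofConjugates, this, map_mul, incl_simple]
      simp only [← mul_assoc, mul_simple_mul_simple]
    · exact ⟨(1, a) :: l, w, by simp [ofConjugates, mul_assoc]⟩

theorem lift_semiGen_ofConjugates (Ψ : Symbol ι) {m : ℕ} (s : Fin m → ι) {N : Type*} [Group N]
    (α : Ψ.W →* MulAut N) (τ : Fin m → N)
    (f : (Ψ.extend s).Group →* N ⋊[α] Ψ.W)
    (hf : ∀ k, f ((Ψ.extend s).simple k) = Ψ.semiGen α τ k)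
    (l : List (Ψ.W × Fin m)) (w : Ψ.W) :
    f (Ψ.ofConjugates s l w) =
      SemidirectProduct.inl (l.map fun p => α p.1 (τ p.2)).prod * SemidirectProduct.inr w := by
  have hincl : ∀ w, f (Ψ.incl s w) = SemidirectProduct.inr w := by
    intro w
    induction w using Ψ.cox.toCoxeterSystem.simple_induction_left with
    | one => simp
    | mul_simple_left w i ih =>
      rw [CoxeterMatrix.toCoxeterSystem_simple, map_mul, map_mul, ih, incl_simple, hf, map_mul]
      rfl
  rw [ofConjugates, map_mul, hincl, map_list_prod,
    map_list_prod (SemidirectProduct.inl : N →* N ⋊[α] Ψ.W), List.map_map, List.map_map]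
  congr 3
  funext p
  simp only [Function.comp_apply, map_mul, map_inv, hincl, hf]
  rw [SemidirectProduct.inl_aut, map_inv]
  rfl

end Symbol

end WeylExt

end

noncomputable section

namespace WeylExt

namespace Symbol

variable {ι : Type*} [Fintype ι] [DecidableEq ι]

/-! ### Labels of the conjugates of the new generators -/

/-- A label: an element of `W(Γ)`, an index, and a vector of the root lattice. -/
def Label (Ψ : Symbol ι) {m : ℕ} (s : Fin m → ι) : Type _ :=
  (Ψ.extend s).Group × Fin m × (ι → ℤ)

/-- `W(Ψ)` acts on labels by conjugation and by its action on the root lattice. -/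
instance (Ψ : Symbol ι) {m : ℕ} (s : Fin m → ι) : MulAction Ψ.W (Ψ.Label s) where
  smul w x := (Ψ.incl s w * x.1 * (Ψ.incl s w)⁻¹, x.2.1, Ψ.rep ℤ w x.2.2)
  one_smul x := by
    obtain ⟨g, a, v⟩ := x
    change (_, _, _) = (g, a, v)
    simp
  mul_smul v w x := by
    change (_, _, _) = (Ψ.incl s v * (Ψ.incl s w * x.1 * (Ψ.incl s w)⁻¹) * (Ψ.incl s v)⁻¹, x.2.1,
      Ψ.rep ℤ v (Ψ.rep ℤ w x.2.2))
    simp [mul_assoc]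

/-- The element of `W(Γ)` of a label. -/
def Label.elt {Ψ : Symbol ι} {m : ℕ} {s : Fin m → ι} (x : Ψ.Label s) : (Ψ.extend s).Group := x.1

/-- The index of a label. -/
def Label.idx {Ψ : Symbol ι} {m : ℕ} {s : Fin m → ι} (x : Ψ.Label s) : Fin m := x.2.1

/-- The vector of a label. -/
def Label.vec {Ψ : Symbol ι} {m : ℕ} {s : Fin m → ι} (x : Ψ.Label s) : ι → ℤ := x.2.2

section

variable (Ψ : Symbol ι) {m : ℕ} (s : Fin m → ι)

theorem idx_smul (w : Ψ.W) (x : Ψ.Label s) : (w • x).idx = x.idx := rfl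

theorem vec_smul (w : Ψ.W) (x : Ψ.Label s) : (w • x).vec = Ψ.rep ℤ w x.vec := rfl

/-- The label of a new generator. -/
def baseLabel (a : Fin m) : Ψ.Label s := ((Ψ.extend s).simple (.inr a), a, Ψ.u (s a))

/-- The label of a conjugate of a new generator. -/
def label (p : Ψ.W × Fin m) : Ψ.Label s := p.1 • Ψ.baseLabel s p.2

theorem label_vec (p : Ψ.W × Fin m) : (Ψ.label s p).vec = Ψ.rep ℤ p.1 (Ψ.u (s p.2)) := rfl

theorem label_elt (p : Ψ.W × Fin m) : (Ψ.label s p).elt =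
    Ψ.incl s p.1 * (Ψ.extend s).simple (.inr p.2) * (Ψ.incl s p.1)⁻¹ := rfl

/-- Such a generator commutes with t_a and fixes u_{s_a}; thus an equivariant family on labels
automatically satisfies the commutation relations of t_a with the nodes not joined to it. -/
theorem simple_smul_baseLabel (i : ι) (a : Fin m) (h : i ≠ s a) :
    Ψ.cox.simple i • Ψ.baseLabel s a = Ψ.baseLabel s a := by
  refine Prod.ext ?_ (Prod.ext rfl ?_)
  · change Ψ.incl s (Ψ.cox.simple i) * (Ψ.extend s).simple (.inr a) *
      (Ψ.incl s (Ψ.cox.simple i))⁻¹ = (Ψ.extend s).simple (.inr a)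
    have hM : Ψ.extend s (.inl i) (.inr a) = 2 := by simp [extend, h]
    have := braid_two (M := Ψ.extend s) (.inl i) (.inr a) hM
    rw [CoxeterMatrix.toCoxeterSystem_simple] at this
    rw [incl_simple, simple_inv, this, mul_simple_mul_simple]
  · change Ψ.rep ℤ (Ψ.cox.simple i) (Ψ.u (s a)) = Ψ.u (s a)
    rw [rep_simple, reflection_apply, Ψ.u_orth (s a) i h, zero_smul, sub_zero]

/-- An equivariant family of involutions indexed by labels gives a homomorphism to a semidirect
product. -/
theorem exists_lift_of_equivariant {N : Type*} [Group N] (α : Ψ.W →* MulAut N)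
    (σ : Ψ.Label s → N) (hσ : ∀ w x, α w (σ x) = σ (w • x)) (hsq : ∀ x, σ x * σ x = 1)
    (hcomm : ∀ a b, Commute (σ (Ψ.baseLabel s a)) (σ (Ψ.baseLabel s b)))
    (hmove : ∀ a, Commute (σ (Ψ.cox.simple (s a) • Ψ.baseLabel s a)) (σ (Ψ.baseLabel s a))) :
    ∃ f : (Ψ.extend s).Group →* N ⋊[α] Ψ.W, ∀ l w, f (Ψ.ofConjugates s l w) =
      SemidirectProduct.inl (l.map fun p => σ (Ψ.label s p)).prod * SemidirectProduct.inr w := by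
  have h := Ψ.semiGen_liftable s α (fun a => σ (Ψ.baseLabel s a)) (fun a => hsq _) hcomm
    (fun i a hi => by rw [hσ, simple_smul_baseLabel Ψ s i a hi]) (fun a => by rw [hσ]; exact hmove a)
  refine ⟨(Ψ.extend s).toCoxeterSystem.lift ⟨_, h⟩, fun l w => ?_⟩
  rw [lift_semiGen_ofConjugates Ψ s α _ _
    (fun k => (Ψ.extend s).toCoxeterSystem.lift_apply_simple h k)]
  simp only [hσ, label]

open scoped Classical in
/-- The labels in a decomposition of an involution are permuted, modulo `2`, by its image in
`W(Ψ)`. -/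
theorem odd_count_smul (l : List (Ψ.W × Fin m)) (w : Ψ.W)
    (h : Ψ.ofConjugates s l w * Ψ.ofConjugates s l w = 1) :
    w * w = 1 ∧ ∀ x, Odd ((l.map (Ψ.label s)).count (w • x)) ↔ Odd ((l.map (Ψ.label s)).count x) := by
  -- With values in the functions from labels to ℤ/2, permuted by W(Ψ), a product of conjugates is
  -- sent to its multiplicities modulo 2.
  let α : Ψ.W →* MulAut (Ψ.Label s → Multiplicative (ZMod 2)) := mulAutArrow
  let σ : Ψ.Label s → Ψ.Label s → Multiplicative (ZMod 2) :=
    fun x y => Multiplicative.ofAdd (if x = y then 1 else 0)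
  have hα : ∀ w f y, α w f y = f (w⁻¹ • y) := fun w f y => rfl
  have h2 : ∀ x : Multiplicative (ZMod 2), x * x = 1 := by decide
  obtain ⟨f, hf⟩ := Ψ.exists_lift_of_equivariant s α σ
    (fun w x => by
      funext y
      rw [hα]
      simp only [σ, eq_inv_smul_iff])
    (fun x => funext fun y => h2 _) (fun a b => Commute.all _ _) (fun a => Commute.all _ _)
  have hcount : ∀ y, (l.map fun p => σ (Ψ.label s p)).prod y =
      Multiplicative.ofAdd ((l.map (Ψ.label s)).count y : ZMod 2) := by
    intro y
    clear h hf
    induction l with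
    | nil => rfl
    | cons p l ih =>
      rw [List.map_cons, List.prod_cons, Pi.mul_apply, ih, List.map_cons, List.count_cons,
        Nat.cast_add, add_comm, ofAdd_add]
      congr 1
      simp only [σ, beq_iff_eq]
      split_ifs <;> simp
  have hg := congrArg f h
  rw [map_mul, hf, map_one] at hg
  set n := (l.map fun p => σ (Ψ.label s p)).prod with hn
  have hl := congrArg SemidirectProduct.left hg
  have hr := congrArg SemidirectProduct.right hg
  simp only [SemidirectProduct.mul_left, SemidirectProduct.mul_right, SemidirectProduct.left_inl,
    SemidirectProduct.right_inl, SemidirectProduct.left_inr, SemidirectProduct.right_inr, map_one,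
    mul_one, one_mul, SemidirectProduct.one_left, SemidirectProduct.one_right] at hl hr
  refine ⟨hr, fun x => ?_⟩
  -- The left component of the square is the multiplicity function times its translate by `w`; at `w
  -- • x` this compares the multiplicities of `w • x` and `x`.
  have hx := congrFun hl (w • x)
  rw [Pi.mul_apply, hα, inv_smul_smul, hcount, hcount, ← ofAdd_add, Pi.one_apply,
    ofAdd_eq_one, ← Nat.cast_add, ZMod.natCast_eq_zero_iff_even, Nat.even_add] at hx
  rw [← Nat.not_even_iff_odd, ← Nat.not_even_iff_odd, hx]

open scoped Classical in
-- In the infinite dihedral group, the parity of the total number of factors `sr` decides between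
-- rotation and reflection, and the parity of the parameter counts the factors `sr 1`. When `x` and
-- `y` both occur an odd number of times, the product is thus a rotation with odd parameter, of
-- infinite order.
theorem dihedral_prod_of_count {X : Type*} {x y : X} (hxy : x ≠ y) (l : List X) :
    (Even (l.count x + l.count y) → ∃ i : ℤ, (l.map fun z => if z = x then DihedralGroup.sr 0
      else if z = y then DihedralGroup.sr 1 else 1).prod = DihedralGroup.r (n := 0) (Int.cast i) ∧
        (Even i ↔ Even (l.count y))) ∧
    (¬ Even (l.count x + l.count y) → ∃ i : ℤ, (l.map fun z => if z = x then DihedralGroup.sr 0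
      else if z = y then DihedralGroup.sr 1 else 1).prod = DihedralGroup.sr (n := 0) (Int.cast i) ∧
        (Even i ↔ Even (l.count y))) := by
  induction l with
  | nil => exact ⟨fun _ => ⟨0, by simp, by simp⟩, fun h => by simp at h⟩
  | cons z l ih =>
    rw [List.map_cons, List.prod_cons, List.count_cons, List.count_cons]
    by_cases h1 : z = x
    · subst h1
      simp only [hxy, if_true, if_false, beq_iff_eq, add_zero, BEq.rfl]
      rw [add_right_comm, Nat.even_add_one]
      refine ⟨fun h => ?_, fun h => ?_⟩
      · obtain ⟨i, hi, hi'⟩ := ih.2 h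
        exact ⟨i, by rw [hi, DihedralGroup.sr_mul_sr, sub_zero], hi'⟩
      · obtain ⟨i, hi, hi'⟩ := ih.1 (not_not.1 h)
        exact ⟨i, by rw [hi, DihedralGroup.sr_mul_r, zero_add], hi'⟩
    · by_cases h2 : z = y
      · subst h2
        simp only [h1, if_true, if_false, beq_iff_eq, add_zero, BEq.rfl]
        rw [← add_assoc, Nat.even_add_one, Nat.even_add_one]
        refine ⟨fun h => ?_, fun h => ?_⟩
        · obtain ⟨i, hi, hi'⟩ := ih.2 h
          refine ⟨i - 1, by rw [hi, DihedralGroup.sr_mul_sr]; simp, ?_⟩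
          rw [← hi', Int.even_sub_one]
        · obtain ⟨i, hi, hi'⟩ := ih.1 (not_not.1 h)
          refine ⟨1 + i, by rw [hi, DihedralGroup.sr_mul_r]; simp, ?_⟩
          rw [← hi', add_comm, Int.even_add_one]
      · simpa [h1, h2] using ih

open scoped Classical in
/-- In a decomposition of an element of finite order of the kernel of `W(Γ) → W(Ψ)`, the vectors
of any two labels that occur an odd number of times are neighbours. -/
theorem form_vec_of_odd_count (l : List (Ψ.W × Fin m))
    (h : IsOfFinOrder (Ψ.ofConjugates s l 1)) (x y : Ψ.Label s) (hxy : x ≠ y)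
    (hidx : x.idx = y.idx) (hx : Odd ((l.map (Ψ.label s)).count x))
    (hy : Odd ((l.map (Ψ.label s)).count y)) :
    Ψ.form x.vec y.vec = Ψ.form (Ψ.u (s y.idx)) (Ψ.u (s y.idx)) -
      pairing ℤ Ψ.cox (s y.idx) (Ψ.u (s y.idx)) ^ 2 := by
  by_contra hbad
  -- The bad pairs are those for which the conclusion fails. The relations of Γ never force the two
  -- members of a bad pair to commute, so each such pair can carry its own infinite dihedral group.
  let bad : Ψ.Label s × Ψ.Label s → Prop := fun q => q.1 ≠ q.2 ∧ q.1.idx = q.2.idx ∧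
    ¬ Ψ.form q.1.vec q.2.vec = Ψ.form (Ψ.u (s q.2.idx)) (Ψ.u (s q.2.idx)) -
      pairing ℤ Ψ.cox (s q.2.idx) (Ψ.u (s q.2.idx)) ^ 2
  have bad_smul : ∀ (w : Ψ.W) q, bad (w • q) ↔ bad q := by
    intro w q
    simp only [bad, Prod.smul_fst, Prod.smul_snd, idx_smul, vec_smul, form_rep, ne_eq,
      smul_left_cancel_iff]
  let α : Ψ.W →* MulAut (Ψ.Label s × Ψ.Label s → DihedralGroup 0) := mulAutArrow
  have hα : ∀ w f q, α w f q = f (w⁻¹ • q) := fun w f y => rfl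
  let σ : Ψ.Label s → Ψ.Label s × Ψ.Label s → DihedralGroup 0 := fun z q =>
    if bad q then (if z = q.1 then DihedralGroup.sr 0 else if z = q.2 then DihedralGroup.sr 1
      else 1) else 1
  -- At a bad pair `q`, distinct non-trivial values occur only when `z` and `z'` are the two members
  -- of `q`.
  have hcomm : ∀ z z', ¬ bad (z, z') → ¬ bad (z', z) → Commute (σ z) (σ z') := by
    intro z z' h1 h2
    refine funext fun q => ?_
    simp only [Pi.mul_apply, σ]
    by_cases hq : bad q
    · by_cases hz : z = q.1 <;> by_cases hz2 : z = q.2 <;> by_cases hz' : z' = q.1 <;>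
        by_cases hz2' : z' = q.2 <;> simp_all
    · simp [hq]
  obtain ⟨f, hf⟩ := Ψ.exists_lift_of_equivariant s α σ
    (fun w z => by
      funext q
      rw [hα]
      simp only [σ, bad_smul, Prod.smul_fst, Prod.smul_snd, eq_inv_smul_iff])
    (fun z => by
      funext q
      simp only [Pi.mul_apply, σ]
      split_ifs <;> simp)
    (fun a b => by
      by_cases hab : a = b
      · subst hab
        exact Commute.refl _
      · exact hcomm _ _ (fun hb => hab hb.2.1) (fun hb => hab hb.2.1.symm))
    (fun a => by
      -- The product of u_s with its reflection u_s - c x_s is N - c². This is the source of the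
      -- value in the statement: it is exactly what makes the pair required to commute by the label
      -- 4 not bad.
      have e : Ψ.form (Ψ.cox.simple (s a) • Ψ.baseLabel s a).vec (Ψ.baseLabel s a).vec =
          Ψ.form (Ψ.u (s a)) (Ψ.u (s a)) - pairing ℤ Ψ.cox (s a) (Ψ.u (s a)) ^ 2 := by
        rw [vec_smul, rep_simple, reflection_apply]
        change Ψ.form (Ψ.u (s a) - _) (Ψ.u (s a)) = _
        rw [map_sub, LinearMap.sub_apply, map_smul, LinearMap.smul_apply,
          Ψ.form_comm (Pi.single _ _), form_single_right, smul_eq_mul, pow_two]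
        rfl
      refine hcomm _ _ (fun hb => hb.2.2 e) (fun hb => hb.2.2 ?_)
      rw [Ψ.form_comm]
      exact e)
  have hb : bad (x, y) := ⟨hxy, hidx, hbad⟩
  obtain ⟨n, hn, hpow⟩ := isOfFinOrder_iff_pow_eq_one.1 h
  have hg := congrArg f hpow
  rw [map_pow, hf, map_one, map_one, mul_one, ← map_pow] at hg
  have hg' := congrFun (SemidirectProduct.inl_injective (hg.trans (map_one _).symm)) (x, y)
  have hprod : (l.map fun p => σ (Ψ.label s p)).prod (x, y) =
      ((l.map (Ψ.label s)).map fun z => if z = x then DihedralGroup.sr 0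
      else if z = y then DihedralGroup.sr 1 else 1).prod := by
    rw [Pi.list_prod_apply, List.map_map, List.map_map]
    congr 2
    funext p
    simp [σ, hb]
  rw [Pi.pow_apply, hprod] at hg'
  obtain ⟨i, hi, hi'⟩ := (dihedral_prod_of_count hxy (l.map (Ψ.label s))).1
    (hx.add_odd hy)
  have hio : ¬ Even i := by
    rwa [hi', Nat.not_even_iff_odd]
  rw [hi, DihedralGroup.r_pow, Pi.one_apply, DihedralGroup.one_def] at hg'
  have h0 := DihedralGroup.r.inj hg'
  have h1 : i * (n : ℤ) = 0 := by exact_mod_cast h0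
  rcases mul_eq_zero.1 h1 with h1 | h1
  · exact hio (by simp [h1])
  · omega

end

end Symbol

end WeylExt

end

/-! ### Torsion in the kernel of φ̂ and in preimages of cyclic 2-groups -/

noncomputable section

namespace WeylExt

open scoped Classical in
/-- In a group of exponent two, a sum over a list only depends on the elements that occur an odd
number of times. -/
theorem list_sum_eq_sum_odd_count {X V : Type*} [AddCommGroup V] (hV : ∀ v : V, v + v = 0)
    (f : X → V) (l : List X) :
    (l.map f).sum = ∑ x ∈ l.toFinset with Odd (l.count x), f x := by
  rw [Finset.sum_list_map_count, Finset.sum_filter]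
  refine Finset.sum_congr rfl fun x _ => ?_
  have h2 : ∀ k : ℕ, (k + k) • f x = 0 := fun k => by rw [add_nsmul, ← nsmul_add, hV, nsmul_zero]
  split_ifs with h
  · obtain ⟨k, hk⟩ := h
    rw [hk, two_mul, add_nsmul, h2, zero_add, one_nsmul]
  · obtain ⟨k, hk⟩ := Nat.not_odd_iff_even.1 h
    rw [hk, h2]

theorem add_self_pi_zmod_two {ι : Type*} (v : ι → ZMod 2) : v + v = 0 :=
  funext fun i => CharTwo.add_self_eq_zero (v i)

theorem red_sum {ι X : Type*} (C : Finset X) (f : X → ι → ℤ) :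
    Symbol.red (∑ x ∈ C, f x) = ∑ x ∈ C, Symbol.red (f x) := by
  classical
  induction C using Finset.induction_on with
  | empty => exact Symbol.red_zero
  | insert a C ha ih => rw [Finset.sum_insert ha, Symbol.red_add, ih, Finset.sum_insert ha]

namespace Symbol

variable {ι : Type*} [Fintype ι] [DecidableEq ι] (Ψ : Symbol ι) {m : ℕ} (s : Fin m → ι)

open scoped Classical in
/-- The labels of index `i` that occur an odd number of times in a decomposition. -/
def oddLabels (l : List (Ψ.W × Fin m)) (i : Fin m) : Finset (Ψ.Label s) :=
  {x ∈ (l.map (Ψ.label s)).toFinset | Odd ((l.map (Ψ.label s)).count x) ∧ x.idx = i}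

open scoped Classical in
theorem mem_oddLabels (l : List (Ψ.W × Fin m)) (i : Fin m) (x : Ψ.Label s) :
    x ∈ Ψ.oddLabels s l i ↔ Odd ((l.map (Ψ.label s)).count x) ∧ x.idx = i := by
  rw [oddLabels, Finset.mem_filter, List.mem_toFinset]
  refine ⟨fun h => h.2, fun h => ⟨?_, h⟩⟩
  exact List.count_pos_iff.1 h.1.pos

theorem exists_eq_label_of_mem_oddLabels {l : List (Ψ.W × Fin m)} {i : Fin m} {x : Ψ.Label s}
    (hx : x ∈ Ψ.oddLabels s l i) : ∃ w, x = Ψ.label s (w, i) := by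
  classical
  rw [oddLabels, Finset.mem_filter, List.mem_toFinset, List.mem_map] at hx
  obtain ⟨⟨p, -, rfl⟩, -, rfl⟩ := hx
  exact ⟨p.1, rfl⟩

open scoped Classical in
-- This lets both φ and ε be read off from the labels of odd multiplicity: φ as the sum of their
-- vectors modulo 2, ε as their number modulo 2.
theorem sum_oddLabels {V : Type*} [AddCommGroup V] (hV : ∀ v : V, v + v = 0)
    (f : Ψ.Label s → V) (l : List (Ψ.W × Fin m)) (i : Fin m) :
    ∑ x ∈ Ψ.oddLabels s l i, f x =
      (l.map fun p => if p.2 = i then f (Ψ.label s p) else 0).sum := by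
  have := list_sum_eq_sum_odd_count hV (fun x : Ψ.Label s => if x.idx = i then f x else 0)
    (l.map (Ψ.label s))
  rw [List.map_map] at this
  rw [oddLabels, ← Finset.filter_filter, Finset.sum_filter, ← this]
  rfl

/-- The component of index `i` of the image under `φ`. -/
theorem phi_ofConjugates_left (l : List (Ψ.W × Fin m)) (w : Ψ.W) (i : Fin m) :
    (((Ψ.phi s (Ψ.ofConjugates s l w)).left.toAdd i : Ψ.Lam (s i)) : ι → ZMod 2) =
      red (∑ x ∈ Ψ.oddLabels s l i, x.vec) := by
  classical
  have h := lift_semiGen_ofConjugates Ψ s (Ψ.act s) (fun a => Multiplicative.ofAdd (Ψ.uvec s a))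
    (Ψ.phi s) (fun k => by
      rw [phi, ← CoxeterMatrix.toCoxeterSystem_simple, CoxeterSystem.lift_apply_simple]
      rcases k with i | a <;> rfl) l w
  rw [h, red_sum, sum_oddLabels Ψ s add_self_pi_zmod_two]
  simp only [SemidirectProduct.mul_left, SemidirectProduct.left_inl, SemidirectProduct.left_inr,
    map_one, mul_one]
  clear h
  induction l with
  | nil => rfl
  | cons p l ih =>
    rw [List.map_cons, List.prod_cons, toAdd_mul, Pi.add_apply, Submodule.coe_add, ih,
      List.map_cons, List.sum_cons]
    congr 1
    change Ψ.rep (ZMod 2) p.1 (Ψ.uvec s p.2 i : ι → ZMod 2) = _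
    split_ifs with hp
    · subst hp
      rw [label_vec, ← rep_red]
      simp [uvec, ubar]
    · rw [uvec, Pi.single_eq_of_ne (Ne.symm hp)]
      simp

theorem phi_ofConjugates_right (l : List (Ψ.W × Fin m)) (w : Ψ.W) :
    (Ψ.phi s (Ψ.ofConjugates s l w)).right = w := by
  have h := lift_semiGen_ofConjugates Ψ s (Ψ.act s) (fun a => Multiplicative.ofAdd (Ψ.uvec s a))
    (Ψ.phi s) (fun k => by
      rw [phi, ← CoxeterMatrix.toCoxeterSystem_simple, CoxeterSystem.lift_apply_simple]
      rcases k with i | a <;> rfl) l w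
  rw [h]
  simp

/-- The component of index `i` of the image under `ε`. -/
theorem eps_ofConjugates (l : List (Ψ.W × Fin m)) (w : Ψ.W) (i : Ψ.NonSpecial s) :
    (Ψ.eps s (Ψ.ofConjugates s l w)).toAdd i = ((Ψ.oddLabels s l i).card : ZMod 2) := by
  classical
  have hgen : ∀ k, Ψ.eps s ((Ψ.extend s).simple k) = Ψ.epsGen s k := fun k => by
    rw [eps, ← CoxeterMatrix.toCoxeterSystem_simple, CoxeterSystem.lift_apply_simple]
  have hincl : ∀ w, Ψ.eps s (Ψ.incl s w) = 1 := by
    intro w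
    induction w using Ψ.cox.toCoxeterSystem.simple_induction_left with
    | one => simp
    | mul_simple_left w i ih =>
      rw [CoxeterMatrix.toCoxeterSystem_simple, map_mul, map_mul, ih, incl_simple, hgen]
      rfl
  rw [Finset.card_eq_sum_ones, Nat.cast_sum, sum_oddLabels Ψ s CharTwo.add_self_eq_zero,
    ofConjugates, map_mul, hincl, mul_one, map_list_prod, List.map_map]
  induction l with
  | nil => rfl
  | cons p l ih =>
    rw [List.map_cons, List.prod_cons, toAdd_mul, Pi.add_apply, ih, List.map_cons, List.sum_cons]
    congr 1
    simp only [Function.comp_apply, map_mul, map_inv, hincl, hgen, one_mul, inv_one, mul_one]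
    simp [epsGen, eq_comm]

/-- An involution of `W(Γ)` with image `(𝐲, w)` under `φ` has components `y_i` that lift to
vectors of the root lattice fixed by `w`. -/
theorem exists_fixed_lift {g : (Ψ.extend s).Group} (hg : g * g = 1) (i : Fin m) :
    ∃ Y, Ψ.rep ℤ (Ψ.phi s g).right Y = Y ∧
      (((Ψ.phi s g).left.toAdd i : Ψ.Lam (s i)) : ι → ZMod 2) = red Y := by
  obtain ⟨l, w, rfl⟩ := Ψ.exists_eq_ofConjugates s g
  -- The lift is the sum of the vectors of the odd labels of index `i`, which `w` permutes among
  -- themselves.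
  refine ⟨_, ?_, Ψ.phi_ofConjugates_left s l w i⟩
  obtain ⟨hw, h⟩ := Ψ.odd_count_smul s l w hg
  have hmem : ∀ x, x ∈ Ψ.oddLabels s l i → w • x ∈ Ψ.oddLabels s l i := fun x hx => by
    rw [mem_oddLabels] at hx ⊢
    exact ⟨(h x).2 hx.1, hx.2⟩
  rw [phi_ofConjugates_right, map_sum]
  refine Finset.sum_nbij' (w • ·) (w • ·) hmem hmem ?_ ?_ ?_
  · intro x _
    rw [smul_smul, hw, one_smul]
  · intro x _
    rw [smul_smul, hw, one_smul]
  · intro x _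
    rw [vec_smul]

/-- The condition on a node that excludes, in the specially admissible case, linear relations
modulo `2` between an odd number of pairwise neighbouring vectors of the orbit of `u_s`. -/
def NoOddRelation (t : ι) : Prop :=
  ∀ (r : ℕ) (f : Fin r → ι → ℤ), Odd r →
    (∀ i, Ψ.form (f i) (f i) = Ψ.form (Ψ.u t) (Ψ.u t)) →
    (∀ i j, i ≠ j → Ψ.form (f i) (f j) = Ψ.form (Ψ.u t) (Ψ.u t) - pairing ℤ Ψ.cox t (Ψ.u t) ^ 2) →
    red (∑ i, f i) ≠ 0

/-- The kernel of `φ̂` is torsion free. -/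
theorem eq_one_of_phiHat_eq_one (hodd : ∀ a, Odd (pairing ℤ Ψ.cox (s a) (Ψ.u (s a))))
    (hspecial : ∀ a, Ψ.SpeciallyAdmissible (s a) → Ψ.NoOddRelation (s a))
    (g : (Ψ.extend s).Group) (hg : Ψ.phiHat s g = 1) (hfin : IsOfFinOrder g) : g = 1 := by
  classical
  obtain ⟨l, w, rfl⟩ := Ψ.exists_eq_ofConjugates s g
  have hphi : Ψ.phi s (Ψ.ofConjugates s l w) = 1 := congrArg Prod.snd hg
  have heps : Ψ.eps s (Ψ.ofConjugates s l w) = 1 := congrArg Prod.fst hg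
  obtain rfl : w = 1 := by
    rw [← Ψ.phi_ofConjugates_right s l w, hphi]
    rfl
  have hempty : ∀ i, Ψ.oddLabels s l i = ∅ := by
    intro i
    by_contra hne
    set C := Ψ.oddLabels s l i with hC
    set N := Ψ.form (Ψ.u (s i)) (Ψ.u (s i)) with hN
    set c := pairing ℤ Ψ.cox (s i) (Ψ.u (s i)) with hc
    have hred : red (∑ x ∈ C, x.vec) = 0 := by
      rw [← Ψ.phi_ofConjugates_left s l 1 i, hphi]
      rfl
    have hself : ∀ x ∈ C, Ψ.form x.vec x.vec = N := by
      intro x hx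
      obtain ⟨v, rfl⟩ := Ψ.exists_eq_label_of_mem_oddLabels s hx
      rw [label_vec, form_rep]
    have hpair : ∀ x ∈ C, ∀ y ∈ C, x ≠ y → Ψ.form x.vec y.vec = N - c ^ 2 := by
      intro x hx y hy hxy
      rw [hC, mem_oddLabels] at hx hy
      obtain ⟨hx, rfl⟩ := hx
      rw [Ψ.form_vec_of_odd_count s l hfin x y hxy hy.2.symm hx hy.1, hy.2]
    rcases Nat.even_or_odd C.card with hr | hr
    -- With r labels, r even, the product of the sum with one of its vectors is N + (r - 1)(N - c²),
    -- which is odd; but the sum lies in 2L.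
    · obtain ⟨x, hx⟩ := Finset.nonempty_iff_ne_empty.2 hne
      obtain ⟨z, hz⟩ := exists_eq_two_smul_of_red_eq_zero hred
      have h1 : Ψ.form (∑ y ∈ C, y.vec) x.vec = N + ((C.erase x).card : ℤ) * (N - c ^ 2) := by
        rw [map_sum, LinearMap.sum_apply, ← Finset.add_sum_erase C _ hx, hself x hx,
          Finset.sum_congr rfl fun y hy => hpair y (Finset.mem_of_mem_erase hy) x hx
            (Finset.ne_of_mem_erase hy), Finset.sum_const, nsmul_eq_mul]
      have h2 : Even (Ψ.form (∑ y ∈ C, y.vec) x.vec) := by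
        rw [hz, map_smul, LinearMap.smul_apply, smul_eq_mul]
        exact even_two_mul _
      have hcard : ¬ Even (((C.erase x).card : ℕ) : ℤ) := by
        rw [Int.even_coe_nat, ← Nat.even_add_one, Finset.card_erase_add_one hx]
        exact hr
      have hNe : Even N := Ψ.even_form_self _
      have hce : ¬ Even c := Int.not_even_iff_odd.2 (hodd i)
      rw [h1, Int.even_add, Int.even_mul, Int.even_sub, Int.even_pow' two_ne_zero] at h2
      tauto
    · by_cases hsp : Ψ.SpeciallyAdmissible (s i)
      · refine hspecial i hsp C.card (fun k => (C.equivFin.symm k : Ψ.Label s).vec) hr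
          (fun k => hself _ (C.equivFin.symm k).2)
          (fun j k hjk => hpair _ (C.equivFin.symm j).2 _ (C.equivFin.symm k).2
            fun h => hjk (C.equivFin.symm.injective (Subtype.ext h))) ?_
        rw [Equiv.sum_comp C.equivFin.symm (fun x : C => (x : Ψ.Label s).vec),
          Finset.sum_coe_sort C (fun x => x.vec)]
        exact hred
      · have := Ψ.eps_ofConjugates s l 1 ⟨i, hsp⟩
        rw [heps] at this
        have h0 : ((C.card : ℕ) : ZMod 2) = 0 := this.symm
        rw [ZMod.natCast_eq_zero_iff_even] at h0
        exact Nat.not_even_iff_odd.2 hr h0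
  have heven : ∀ x : Ψ.Label s, Even ((l.map (Ψ.label s)).count x) := by
    intro x
    by_contra hx
    have : x ∈ Ψ.oddLabels s l x.idx :=
      (Ψ.mem_oddLabels s l _ x).2 ⟨Nat.not_even_iff_odd.1 hx, rfl⟩
    rw [hempty] at this
    exact absurd this (Finset.notMem_empty x)
  -- The endomorphism `P` is attached to the label and not to its occurrence. Equal labels therefore
  -- contribute equal terms, and even multiplicities make the sum of the terms divisible by 2.
  have hP : ∀ x : Ψ.Label s, ∃ P, x ∈ l.map (Ψ.label s) →
      Ψ.extendRep s x.elt = 1 - (2 : ℤ) • P := by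
    intro x
    by_cases hx : x ∈ l.map (Ψ.label s)
    · obtain ⟨p, -, rfl⟩ := List.mem_map.1 hx
      obtain ⟨P, hP⟩ := Ψ.exists_extendRep_simple_inr s p.2
      refine ⟨Ψ.extendRep s (Ψ.incl s p.1) * P * Ψ.extendRep s (Ψ.incl s p.1)⁻¹, fun _ => ?_⟩
      rw [label_elt, map_mul, map_mul, hP, mul_sub, sub_mul, mul_one, ← map_mul, mul_inv_cancel,
        map_one, mul_smul_comm, smul_mul_assoc]
    · exact ⟨0, fun h => absurd h hx⟩
  choose P hP using hP
  obtain ⟨R, hR⟩ := exists_prod_eq_one_sub_add (fun x : Ψ.Label s => Ψ.extendRep s x.elt) P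
    (l.map (Ψ.label s)) hP
  have hrep : Ψ.extendRep s (Ψ.ofConjugates s l 1) =
      ((l.map (Ψ.label s)).map fun x => Ψ.extendRep s x.elt).prod := by
    rw [ofConjugates, map_one, mul_one, map_list_prod, List.map_map, List.map_map]
    rfl
  choose k hk using heven
  have hsum : ((l.map (Ψ.label s)).map P).sum =
      (2 : ℤ) • ∑ x ∈ (l.map (Ψ.label s)).toFinset, k x • P x := by
    rw [Finset.sum_list_map_count, Finset.smul_sum]
    refine Finset.sum_congr rfl fun x _ => ?_
    rw [hk x, add_nsmul, two_smul]
  obtain ⟨n, hn, hpow⟩ := isOfFinOrder_iff_pow_eq_one.1 hfin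
  refine Ψ.extendRep_injective s ((eq_one_of_isOfFinOrder_of_congr _
    (R - ∑ x ∈ (l.map (Ψ.label s)).toFinset, k x • P x) ?_ n hn ?_).trans (map_one _).symm)
  · rw [hrep, hR, hsum]
    module
  · rw [← map_pow, hpow, map_one]

/-- A criterion for the preimage of a cyclic `2`-group to be torsion free. -/
theorem torsionFree_comap_zpowers (hodd : ∀ a, Odd (pairing ℤ Ψ.cox (s a) (Ψ.u (s a))))
    (hspecial : ∀ a, Ψ.SpeciallyAdmissible (s a) → Ψ.NoOddRelation (s a))
    (ζ : Ψ.Target s) (k : ℕ) (hζ : ζ ^ 2 ^ (k + 1) = 1)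
    (hfix : ∀ Y, Ψ.rep ℤ (ζ ^ 2 ^ k).2.right Y = Y → (4 : ℤ) ∣ Ψ.form Y Y)
    (i : Fin m) (y : ι → ℤ)
    (hy : (((ζ ^ 2 ^ k).2.left.toAdd i : Ψ.Lam (s i)) : ι → ZMod 2) = red y)
    (hy4 : ¬ (4 : ℤ) ∣ Ψ.form y y) :
    TorsionFree ((Subgroup.zpowers ζ).comap (Ψ.phiHat s)) := by
  intro g hg hfin
  have hker := Ψ.eq_one_of_phiHat_eq_one s hodd hspecial
  by_cases h1 : Ψ.phiHat s g = 1
  · exact hker g h1 hfin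
  exfalso
  have hζfin : IsOfFinOrder ζ := isOfFinOrder_iff_pow_eq_one.2 ⟨_, by positivity, hζ⟩
  obtain ⟨n, hn⟩ := (hζfin.mem_powers_iff_mem_zpowers).2 (Subgroup.mem_comap.1 hg)
  have hn' : ζ ^ n = Ψ.phiHat s g := hn
  have hn0 : n ≠ 0 := by
    rintro rfl
    exact h1 (by rw [← hn', pow_zero])
  obtain ⟨e, q, hq, rfl⟩ := Nat.exists_eq_two_pow_mul_odd hn0
  have hek : e ≤ k := by
    by_contra hlt
    obtain ⟨d, rfl⟩ := Nat.exists_eq_add_of_le (not_le.1 hlt : k + 1 ≤ e)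
    exact h1 (by rw [← hn', pow_add, mul_assoc, pow_mul, hζ, one_pow])
  -- A suitable power of `g` lies over the involution ζ^(2^k); its square lies in the torsion free
  -- kernel, hence is trivial.
  have hh : Ψ.phiHat s (g ^ 2 ^ (k - e)) = ζ ^ 2 ^ k := by
    obtain ⟨j, rfl⟩ := hq
    rw [map_pow, ← hn', ← pow_mul, mul_right_comm, ← pow_add, Nat.add_sub_cancel' hek, mul_add,
      mul_one, pow_add, ← mul_assoc, ← pow_succ, pow_mul, hζ, one_pow, one_mul]
  set h := g ^ 2 ^ (k - e) with hdef
  have hsq : h * h = 1 := by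
    refine hker _ ?_ ?_
    · rw [map_mul, hh, ← pow_add, ← two_mul, ← pow_succ', hζ]
    · rw [← pow_two]
      exact (hfin.pow).pow
  obtain ⟨Y, hY, hYr⟩ := Ψ.exists_fixed_lift s hsq i
  have hphi : Ψ.phi s h = (ζ ^ 2 ^ k).2 := congrArg Prod.snd hh
  rw [hphi] at hY hYr
  -- The fixed lift `Y` and `y` have the same class in L/2, hence the same norm modulo 4.
  have := Ψ.form_self_congr (hYr.symm.trans hy)
  exact hy4 ((dvd_sub_right (hfix Y hY)).1 this)

end Symbol

end WeylExt

end

noncomputable section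

namespace WeylExt

namespace Symbol

variable {ι : Type*} [Fintype ι] [DecidableEq ι] (Ψ : Symbol ι)

theorem rep_eq_cartanRep : Ψ.rep ℤ = cartanRep Ψ.isCartan_cartan := by
  refine Ψ.cox.toCoxeterSystem.ext_simple fun i => ?_
  rw [cartanRep_simple, CoxeterMatrix.toCoxeterSystem_simple, rep_simple]
  refine LinearMap.ext fun v => ?_
  rw [cartanReflection_apply, reflection_apply]
  simp [pairing]

theorem rep_int_injective : Function.Injective (Ψ.rep ℤ) := by
  rw [rep_eq_cartanRep]
  exact cartanRep_injective _

theorem form_apply (v w : ι → ℤ) : Ψ.form v w = ∑ j, pairing ℤ Ψ.cox j v * w j := by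
  conv_lhs => rw [pi_eq_sum_univ' w]
  rw [map_sum]
  refine Finset.sum_congr rfl fun j _ => ?_
  rw [map_smul, form_single_right, smul_eq_mul, mul_comm]

/-! ### Consequences of admissibility -/

theorem reflection_ubar_self (t : ι) :
    reflection (ZMod 2) Ψ.cox t (Ψ.ubar t) =
      Ψ.ubar t - ((pairing ℤ Ψ.cox t (Ψ.u t) : ℤ) : ZMod 2) • Pi.single t 1 := by
  rw [ubar, reflection_red, reflection_apply, red_sub]
  congr 1
  funext j
  simp [red, Pi.single_apply]

/-- Only the path with one node is used: if the pairing were even, the two vectors attached to it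
would coincide. -/
theorem odd_pairing_of_admissible (t : ι) (h : Ψ.Admissible t) :
    Odd (pairing ℤ Ψ.cox t (Ψ.u t)) := by
  rw [← Int.not_even_iff_odd]
  intro heven
  have hind := h t .nil SimpleGraph.Walk.IsPath.nil (by simp)
  have hinj := hind.injective
  have h0 : ((pairing ℤ Ψ.cox t (Ψ.u t) : ℤ) : ZMod 2) = 0 :=
    (ZMod.intCast_zmod_eq_zero_iff_dvd _ 2).2 heven.two_dvd
  have hv : Ψ.vectorsX t (SimpleGraph.Walk.nil : Ψ.graph.Walk t t).support =
      [Ψ.ubar t, Ψ.ubar t] := by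
    simp [vectorsX, rep_simple, reflection_ubar_self, h0]
  rw [hv] at hinj
  have := @hinj ⟨0, by simp⟩ ⟨1, by simp⟩ rfl
  simp at this

/-- If `ū_s` is a combination of the simple roots of the nodes of a path from `s`, then `(Ψ, s)` is
not specially admissible. -/
theorem not_speciallyAdmissible_of_path {t t' : ι} (p : Ψ.graph.Walk t t') (hp : p.IsPath)
    (h : ∀ j, Odd (Ψ.u t j) → j ∈ p.support) : ¬ Ψ.SpeciallyAdmissible t := by
  intro hsp
  have hind := hsp t' p hp
  let S : Set (ι → ZMod 2) := ↑(p.support.toFinset.image fun j => (Pi.single j 1 : ι → ZMod 2))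
  have hS : ∀ j ∈ p.support, (Pi.single j 1 : ι → ZMod 2) ∈ Submodule.span (ZMod 2) S := by
    intro j hj
    refine Submodule.subset_span ?_
    simp only [S, Finset.coe_image, List.coe_toFinset]
    exact ⟨j, hj, rfl⟩
  have hu : Ψ.ubar t ∈ Submodule.span (ZMod 2) S := by
    rw [pi_eq_sum_univ' (Ψ.ubar t)]
    refine Submodule.sum_mem _ fun j _ => ?_
    by_cases hj : Odd (Ψ.u t j)
    · exact Submodule.smul_mem _ _ (hS j (h j hj))
    · have h0 : Ψ.ubar t j = 0 :=
        (ZMod.intCast_zmod_eq_zero_iff_dvd _ 2).2 (Int.not_odd_iff_even.1 hj).two_dvd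
      rw [h0, zero_smul]
      exact Submodule.zero_mem _
  have hscan : ∀ (l : List ι) (v : ι → ZMod 2), (∀ j ∈ l, j ∈ p.support) →
      v ∈ Submodule.span (ZMod 2) S →
      ∀ x ∈ l.scanl (fun v i => Ψ.rep (ZMod 2) (Ψ.cox.simple i) v) v,
        x ∈ Submodule.span (ZMod 2) S := by
    intro l
    induction l with
    | nil =>
      intro v _ hv x hx
      simp only [List.scanl_nil, List.mem_singleton] at hx
      rwa [hx]
    | cons a l ih =>
      intro v hl hv x hx
      rw [List.scanl_cons, List.mem_cons] at hx
      rcases hx with rfl | hx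
      · exact hv
      · refine ih _ (fun j hj => hl j (List.mem_cons_of_mem _ hj)) ?_ x hx
        rw [rep_simple, reflection_apply]
        exact Submodule.sub_mem _ hv (Submodule.smul_mem _ _ (hS a (hl a List.mem_cons_self)))
  -- A path with k nodes gives k + 1 vectors in the span of k simple roots.
  have hle := linearIndependent_le_span_aux' _ hind
    ↑(p.support.toFinset.image fun j => (Pi.single j 1 : ι → ZMod 2)) (by
      rintro _ ⟨j, rfl⟩
      exact hscan p.support _ (fun j hj => hj) hu _ (List.get_mem _ _))
  simp only [Fintype.card_fin, Finset.coe_sort_coe, Fintype.card_coe] at hle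
  have h1 := Finset.card_image_le (s := p.support.toFinset)
    (f := fun j => (Pi.single j 1 : ι → ZMod 2))
  have h2 := List.toFinset_card_le p.support
  have h3 : (Ψ.vectorsX t p.support).length = p.support.length + 1 := by
    simp [vectorsX]
  omega

/-- An invariant subspace of `L / 2L` that contains a simple root is everything. -/
theorem eq_top_of_single_mem (hconn : Ψ.graph.Preconnected)
    (S : Submodule (ZMod 2) (ι → ZMod 2))
    (hS : ∀ i, ∀ v ∈ S, reflection (ZMod 2) Ψ.cox i v ∈ S) (t : ι)
    (ht : (Pi.single t 1 : ι → ZMod 2) ∈ S) : S = ⊤ := by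
  have hall : ∀ j, (Pi.single j 1 : ι → ZMod 2) ∈ S := by
    intro j
    obtain ⟨p⟩ := hconn t j
    induction p with
    | nil => exact ht
    | @cons a b _ hab p ih =>
      refine ih ?_
      -- The reflection in a neighbour adds the neighbouring root, so simple roots spread along
      -- edges.
      have h1 := hS b _ ht
      rw [reflection_apply, pairing_single] at h1
      have hne : a ≠ b := hab.ne
      have h3 : Ψ.cox a b = 3 := hab
      have hc : cartan Ψ.cox a b = -1 := by simp [cartan, hne, h3]
      rw [hc] at h1
      have h2 := S.sub_mem h1 ht
      simpa using h2
  rw [eq_top_iff]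
  intro v _
  rw [pi_eq_sum_univ' v]
  exact Submodule.sum_mem _ fun j _ => Submodule.smul_mem _ _ (hall j)

theorem single_sub_ubar_of_odd (t : ι) (h : Odd (pairing ℤ Ψ.cox t (Ψ.u t))) :
    Ψ.ubar t - reflection (ZMod 2) Ψ.cox t (Ψ.ubar t) = Pi.single t 1 := by
  have h1 : ((pairing ℤ Ψ.cox t (Ψ.u t) : ℤ) : ZMod 2) = 1 := by
    obtain ⟨k, hk⟩ := h
    rw [hk]
    push_cast
    rw [(CharTwo.two_eq_zero : (2 : ZMod 2) = 0), zero_mul, zero_add]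
  rw [reflection_ubar_self, h1, one_smul, sub_sub_cancel]

theorem Lam_eq_top (hconn : Ψ.graph.Preconnected) (t : ι)
    (h : Odd (pairing ℤ Ψ.cox t (Ψ.u t))) : Ψ.Lam t = ⊤ := by
  refine Ψ.eq_top_of_single_mem hconn _ (fun i v hv => ?_) t ?_
  · rw [← rep_simple]
    exact Ψ.rep_mem_Lam t _ hv
  · rw [← Ψ.single_sub_ubar_of_odd t h]
    refine Submodule.sub_mem _ (Ψ.ubar_mem_Lam t) ?_
    rw [← rep_simple]
    exact Ψ.rep_mem_Lam t _ (Ψ.ubar_mem_Lam t)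

end Symbol

end WeylExt

end

noncomputable section

namespace WeylExt

open WeylExt.Symbol

/-! ### Type `A` -/

/-- The coordinates of a vector of the root lattice of `A_n`, shifted by one and extended by zero. -/
def extA {n : ℕ} (v : Fin n → ℤ) (j : ℕ) : ℤ :=
  if h : 1 ≤ j ∧ j ≤ n then v ⟨j - 1, by omega⟩ else 0

/-- The coordinates of a vector of the root lattice of `A_n` in `ℤ^(n+1)`. -/
def epsA {n : ℕ} (v : Fin n → ℤ) (j : ℕ) : ℤ := extA v (j + 1) - extA v j

theorem extA_zero {n : ℕ} (v : Fin n → ℤ) : extA v 0 = 0 := by simp [extA]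

theorem extA_last {n : ℕ} (v : Fin n → ℤ) : extA v (n + 1) = 0 := by simp [extA]

theorem extA_succ {n : ℕ} (v : Fin n → ℤ) (j : Fin n) : extA v (j + 1) = v j := by
  have := j.2
  simp [extA, this]

theorem pairing_extA {n : ℕ} (v : Fin n → ℤ) (t : Fin n) :
    pairing ℤ (CoxeterMatrix.A n) t v = 2 * extA v (t + 1) - extA v t - extA v (t + 2) := by
  rw [← pairing_typeA n t (extA v) (extA_zero v) (extA_last v)]
  congr 1
  funext j
  rw [extA_succ]

theorem extA_eq_sum {n : ℕ} (v : Fin n → ℤ) (j : ℕ) :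
    extA v j = ∑ i ∈ Finset.range j, epsA v i := by
  simp only [epsA]
  rw [Finset.sum_range_sub, extA_zero, sub_zero]

theorem eq_of_epsA_eq {n : ℕ} {v w : Fin n → ℤ} (h : ∀ j ≤ n, epsA v j = epsA w j) : v = w := by
  funext j
  have := j.2
  rw [← extA_succ v, ← extA_succ w, extA_eq_sum, extA_eq_sum]
  refine Finset.sum_congr rfl fun i hi => h i ?_
  have := Finset.mem_range.1 hi
  omega

theorem extA_reflection {n : ℕ} (v : Fin n → ℤ) (t : Fin n) (j : ℕ) :
    extA (reflection ℤ (CoxeterMatrix.A n) t v) j =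
      if j = t + 1 then extA v t + extA v (t + 2) - extA v (t + 1) else extA v j := by
  have ht := t.2
  rw [reflection_apply, pairing_extA]
  by_cases hj : j = t + 1
  · subst hj
    rw [extA_succ, if_pos rfl, Pi.sub_apply, ← extA_succ v t]
    simp
    ring
  · rw [if_neg hj]
    generalize 2 * extA v (t + 1) - extA v t - extA v (t + 2) = c
    unfold extA
    split_ifs with h
    · have hne : (⟨j - 1, by omega⟩ : Fin n) ≠ t := fun h' => hj (by
        have := congrArg Fin.val h'
        simp only at this
        omega)
      simp [Pi.single_eq_of_ne hne]
    · rfl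

/-- The simple root of `t` is ε_t - ε_(t+1), so W(A_n) acts as the symmetric group on n + 1
coordinates; the Coxeter element becomes the cyclic shift, from which its powers and its order are
read off. -/
theorem epsA_reflection {n : ℕ} (v : Fin n → ℤ) (t : Fin n) (j : ℕ) :
    epsA (reflection ℤ (CoxeterMatrix.A n) t v) j =
      if j = t then epsA v (t + 1) else if j = t + 1 then epsA v t else epsA v j := by
  simp only [epsA, extA_reflection]
  split_ifs with h1 h2 h3 h4 h5 h6 <;> first | omega | skip
  all_goals subst_vars; try ring_nf

/-- Partial products of the Coxeter element of `A_n`. -/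
theorem epsA_rep_prod {n : ℕ} (v : Fin n → ℤ) (k : ℕ) (hk : k ≤ n) (j : ℕ) :
    epsA ((typeA n).rep ℤ
      (((List.finRange n).take k).map fun i => (typeA n).cox.simple i).prod v) j =
      if j = 0 then epsA v k else if j ≤ k then epsA v (j - 1) else epsA v j := by
  induction k generalizing v with
  | zero =>
    simp only [List.take_zero, List.map_nil, List.prod_nil, map_one, Module.End.one_apply,
      Nat.le_zero]
    split_ifs with h
    · rw [h]
    · rfl
  | succ k ih =>
    have hlen : k < (List.finRange n).length := by simpa using hk
    rw [List.take_add_one, List.getElem?_eq_getElem hlen, Option.toList_some, List.map_append,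
      List.prod_append, map_mul, Module.End.mul_apply, ih _ (by omega)]
    simp only [List.map_cons, List.map_nil, List.prod_singleton, List.getElem_finRange, rep_simple]
    change (if j = 0 then epsA (reflection ℤ (CoxeterMatrix.A n) _ v) _ else _) = _
    simp only [typeA, epsA_reflection, Fin.val_cast]
    split_ifs <;> first | omega | rfl | (congr 1; omega)

theorem epsA_rep_coxeterElementA {n : ℕ} (v : Fin n → ℤ) (j : ℕ) (hj : j ≤ n) :
    epsA ((typeA n).rep ℤ (coxeterElementA n) v) ((j + 1) % (n + 1)) = epsA v j := by
  have h : coxeterElementA n =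
      (((List.finRange n).take n).map fun i => (typeA n).cox.simple i).prod := by
    rw [List.take_of_length_le (by simp), coxeterElementA, List.ofFn_eq_map]
  rw [h, epsA_rep_prod v n le_rfl]
  rcases hj.eq_or_lt with rfl | hlt
  · simp
  · rw [Nat.mod_eq_of_lt (by omega), if_neg (by omega), if_pos (by omega), Nat.add_sub_cancel]

theorem epsA_rep_pow {n : ℕ} (v : Fin n → ℤ) (k j : ℕ) (hj : j ≤ n) :
    epsA ((typeA n).rep ℤ (coxeterElementA n ^ k) v) ((j + k) % (n + 1)) = epsA v j := by
  induction k with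
  | zero => simp [Nat.mod_eq_of_lt (Nat.lt_succ_of_le hj)]
  | succ k ih =>
    rw [pow_succ', map_mul, Module.End.mul_apply, ← add_assoc, ← Nat.mod_add_mod,
      epsA_rep_coxeterElementA _ _ (Nat.le_of_lt_succ (Nat.mod_lt _ (Nat.succ_pos n))), ih]

theorem epsA_single_zero {n : ℕ} (hn : 0 < n) (j : ℕ) :
    epsA (Pi.single (⟨0, hn⟩ : Fin n) 1) j = if j = 0 then 1 else if j = 1 then -1 else 0 := by
  have : ∀ j, extA (Pi.single (⟨0, hn⟩ : Fin n) 1) j = if j = 1 then 1 else 0 := by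
    intro j
    unfold extA
    split_ifs with h1 h2 h2
    · subst h2
      simp
    · rw [Pi.single_eq_of_ne]
      intro h
      have := congrArg Fin.val h
      simp only at this
      omega
    · omega
    · rfl
  simp only [epsA, this]
  split_ifs <;> omega

theorem coxeterNumberA_eq {n : ℕ} (hn : 0 < n) : coxeterNumberA n = n + 1 := by
  refine (orderOf_eq_iff (Nat.succ_pos n)).2 ⟨?_, fun k hk hk0 h => ?_⟩
  · refine (typeA n).rep_int_injective (LinearMap.ext fun v => eq_of_epsA_eq fun j hj => ?_)
    have := epsA_rep_pow v (n + 1) j hj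
    rw [Nat.add_mod_right, Nat.mod_eq_of_lt (Nat.lt_succ_of_le hj)] at this
    rw [this, map_one, Module.End.one_apply]
  · have := epsA_rep_pow (Pi.single (⟨0, hn⟩ : Fin n) 1) k 0 (Nat.zero_le n)
    rw [h, map_one, Module.End.one_apply, zero_add, Nat.mod_eq_of_lt hk, epsA_single_zero,
      epsA_single_zero] at this
    split_ifs at this <;> omega

theorem form_typeA {n : ℕ} (v : Fin n → ℤ) :
    (typeA n).form v v = ∑ j ∈ Finset.range (n + 1), epsA v j ^ 2 := by
  have h1 : (typeA n).form v v = ∑ t ∈ Finset.range n,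
      (2 * extA v (t + 1) - extA v t - extA v (t + 2)) * extA v (t + 1) := by
    rw [form_apply, ← Fin.sum_univ_eq_sum_range
      (fun t => (2 * extA v (t + 1) - extA v t - extA v (t + 2)) * extA v (t + 1))]
    refine Finset.sum_congr rfl fun t _ => ?_
    rw [← pairing_extA, extA_succ v t]
    rfl
  -- Summation by parts; the boundary terms vanish for `k = n`.
  have h2 : ∀ k, ∑ j ∈ Finset.range (k + 1), epsA v j ^ 2 = (∑ t ∈ Finset.range k,
      (2 * extA v (t + 1) - extA v t - extA v (t + 2)) * extA v (t + 1)) +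
      extA v (k + 1) ^ 2 - extA v k * extA v (k + 1) := by
    intro k
    induction k with
    | zero => simp [epsA, extA_zero]
    | succ k ih =>
      rw [Finset.sum_range_succ, ih, Finset.sum_range_succ _ k, epsA]
      ring
  rw [h1, h2, extA_last]
  ring

/-- A vector fixed by the fixed point free involution has norm divisible by `4`. -/
theorem four_dvd_form_of_fixed {N : ℕ} (n : ℕ) (hn : n + 1 = 2 * N) (Y : Fin n → ℤ)
    (hY : (typeA n).rep ℤ (coxeterElementA n ^ N) Y = Y) : (4 : ℤ) ∣ (typeA n).form Y Y := by
  have h : ∀ j < N, epsA Y (N + j) = epsA Y j := by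
    intro j hj
    have := epsA_rep_pow Y N j (by omega)
    rwa [hY, Nat.mod_eq_of_lt (by omega), add_comm] at this
  have hsum : ∀ f : ℤ → ℤ, ∑ j ∈ Finset.range (n + 1), f (epsA Y j) =
      2 * ∑ j ∈ Finset.range N, f (epsA Y j) := by
    intro f
    rw [hn, two_mul N, Finset.sum_range_add, two_mul]
    congr 1
    exact Finset.sum_congr rfl fun j hj => by rw [h j (Finset.mem_range.1 hj)]
  have h0 : ∑ j ∈ Finset.range N, epsA Y j = 0 := by
    have := hsum fun x => x
    rw [← extA_eq_sum, extA_last] at this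
    omega
  rw [form_typeA, hsum fun x => x ^ 2]
  -- The coordinates of `Y` have period N and half of them already sum to 0; since x² ≡ x modulo 2,
  -- the sum of the squares over that half is even.
  have h2 : (2 : ℤ) ∣ ∑ j ∈ Finset.range N, epsA Y j ^ 2 := by
    rw [← sub_zero (∑ j ∈ Finset.range N, epsA Y j ^ 2), ← h0, ← Finset.sum_sub_distrib]
    refine Finset.dvd_sum fun j _ => ?_
    rw [pow_two]
    exact (Int.even_mul_pred_self (epsA Y j)).two_dvd.trans (by rw [mul_sub, mul_one])
  exact mul_dvd_mul_left 2 h2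

/-- The sum of the first `N` simple roots. -/
def halfRootA (n N : ℕ) : Fin n → ℤ := fun j => if (j : ℕ) < N then 1 else 0

theorem epsA_halfRootA {n N : ℕ} (hN : 0 < N) (hn : n + 1 = 2 * N) (j : ℕ) :
    epsA (halfRootA n N) j = if j = 0 then 1 else if j = N then -1 else 0 := by
  have : ∀ j, extA (halfRootA n N) j = if 1 ≤ j ∧ j ≤ N then 1 else 0 := by
    intro j
    unfold extA halfRootA
    simp only
    split_ifs <;> omega
  simp only [epsA, this]
  split_ifs <;> omega

theorem form_halfRootA {n N : ℕ} (hN : 0 < N) (hn : n + 1 = 2 * N) :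
    (typeA n).form (halfRootA n N) (halfRootA n N) = 2 := by
  have : ∀ j, epsA (halfRootA n N) j ^ 2 = (if j = 0 then 1 else 0) + if j = N then 1 else 0 := by
    intro j
    rw [epsA_halfRootA hN hn]
    split_ifs <;> omega
  simp only [form_typeA, this, Finset.sum_add_distrib, Finset.sum_ite_eq', Finset.mem_range]
  rw [if_pos (by omega), if_pos (by omega)]
  norm_num

/-- The vector is the root ε_0 - ε_N, whose two coordinates are exchanged by the shift by N. It is
fixed modulo 2 without being fixed. -/
theorem rep_halfRootA {n N : ℕ} (hN : 0 < N) (hn : n + 1 = 2 * N) :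
    (typeA n).rep ℤ (coxeterElementA n ^ N) (halfRootA n N) = -halfRootA n N := by
  refine eq_of_epsA_eq fun j hj => ?_
  have hneg : epsA (-halfRootA n N) j = -epsA (halfRootA n N) j := by
    have : ∀ j, extA (-halfRootA n N) j = -extA (halfRootA n N) j := by
      intro j
      unfold extA
      split_ifs <;> simp
    simp only [epsA, this]
    ring
  rw [hneg]
  rcases lt_or_ge j N with h | h
  · have := epsA_rep_pow (halfRootA n N) N (j + N) (by omega)
    rw [add_assoc, ← two_mul, ← hn, Nat.add_mod_right, Nat.mod_eq_of_lt (by omega)] at this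
    rw [this, epsA_halfRootA hN hn, epsA_halfRootA hN hn]
    split_ifs <;> omega
  · have := epsA_rep_pow (halfRootA n N) N (j - N) (by omega)
    rw [Nat.sub_add_cancel h, Nat.mod_eq_of_lt (by omega)] at this
    rw [this, epsA_halfRootA hN hn, epsA_halfRootA hN hn]
    split_ifs <;> omega

/-! ### Paths in type `A` and admissibility -/

theorem adj_typeA {n : ℕ} (i j : Fin n) :
    (typeA n).graph.Adj i j ↔ (j : ℕ) + 1 = i ∨ (i : ℕ) + 1 = j := by
  change CoxeterMatrix.A n i j = 3 ↔ _
  simp only [CoxeterMatrix.A, Matrix.of_apply, Fin.ext_iff]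
  split_ifs with h1 h2 <;> omega

theorem exists_path_down {n : ℕ} (s : Fin n) : ∃ (t : Fin n) (p : (typeA n).graph.Walk s t),
    p.IsPath ∧ ∀ j, j ∈ p.support ↔ j ≤ s := by
  induction hk : (s : ℕ) generalizing s with
  | zero =>
    refine ⟨s, .nil, SimpleGraph.Walk.IsPath.nil, fun j => ?_⟩
    simp only [SimpleGraph.Walk.support_nil, List.mem_singleton, Fin.ext_iff, Fin.le_def]
    omega
  | succ k ih =>
    obtain ⟨t, p, hp, h⟩ := ih ⟨k, by omega⟩ rfl
    refine ⟨t, .cons ((adj_typeA s ⟨k, by omega⟩).2 (Or.inl hk.symm)) p, ?_, fun j => ?_⟩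
    · rw [SimpleGraph.Walk.cons_isPath_iff]
      refine ⟨hp, fun hs => ?_⟩
      have := (h s).1 hs
      rw [Fin.le_def] at this
      simp only at this
      omega
    · rw [SimpleGraph.Walk.support_cons, List.mem_cons, h, Fin.le_def, Fin.le_def, Fin.ext_iff]
      simp only
      omega

theorem exists_path_up {n : ℕ} (s : Fin n) : ∃ (t : Fin n) (p : (typeA n).graph.Walk s t),
    p.IsPath ∧ ∀ j, j ∈ p.support ↔ s ≤ j := by
  induction hk : n - 1 - (s : ℕ) generalizing s with
  | zero =>
    refine ⟨s, .nil, SimpleGraph.Walk.IsPath.nil, fun j => ?_⟩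
    have := j.2
    simp only [SimpleGraph.Walk.support_nil, List.mem_singleton, Fin.ext_iff, Fin.le_def]
    omega
  | succ k ih =>
    have hs := s.2
    obtain ⟨t, p, hp, h⟩ := ih ⟨s + 1, by omega⟩ (by simp only; omega)
    refine ⟨t, .cons ((adj_typeA s ⟨s + 1, by omega⟩).2 (Or.inr rfl)) p, ?_, fun j => ?_⟩
    · rw [SimpleGraph.Walk.cons_isPath_iff]
      refine ⟨hp, fun hs => ?_⟩
      have := (h s).1 hs
      rw [Fin.le_def] at this
      simp only at this
      omega
    · rw [SimpleGraph.Walk.support_cons, List.mem_cons, h, Fin.le_def, Fin.le_def, Fin.ext_iff]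
      simp only
      omega

theorem preconnected_typeA (n : ℕ) : (typeA n).graph.Preconnected := by
  intro a b
  obtain ⟨t, p, -, h⟩ := exists_path_down a
  obtain ⟨t', p', -, h'⟩ := exists_path_down b
  rcases le_total a b with hab | hab
  · exact ⟨((p'.takeUntil a ((h' a).2 hab))).reverse⟩
  · exact ⟨p.takeUntil b ((h b).2 hab)⟩

/-- For odd rank, no admissible node of `A_n` is specially admissible. -/
theorem not_speciallyAdmissible_typeA {n : ℕ} (hn : Odd n) (s : Fin n)
    (h : Odd (pairing ℤ (typeA n).cox s ((typeA n).u s))) :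
    ¬ (typeA n).SpeciallyAdmissible s := by
  have hs := s.2
  obtain ⟨a, ha⟩ := Nat.gcd_dvd_right ((s : ℕ) + 1) (n - s)
  obtain ⟨b, hb⟩ := Nat.gcd_dvd_left ((s : ℕ) + 1) (n - s)
  have hd : 0 < Nat.gcd ((s : ℕ) + 1) (n - s) := Nat.gcd_pos_of_pos_left _ (by omega)
  have hA : (n - s) / Nat.gcd ((s : ℕ) + 1) (n - s) = a := Nat.div_eq_of_eq_mul_right hd ha
  have hB : ((s : ℕ) + 1) / Nat.gcd ((s : ℕ) + 1) (n - s) = b := Nat.div_eq_of_eq_mul_right hd hb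
  have hu : ∀ j : Fin n, (typeA n).u s j =
      if (j : ℕ) ≤ s then ((((j : ℕ) + 1) * a : ℕ) : ℤ) else (((n - j) * b : ℕ) : ℤ) := by
    intro j
    change uA n s j = _
    simp only [uA, hA, hB]
  have hext : ∀ j ≤ n + 1, extA ((typeA n).u s) j =
      if j ≤ s + 1 then ((j * a : ℕ) : ℤ) else (((n + 1 - j) * b : ℕ) : ℤ) := by
    intro j hj
    rcases Nat.eq_zero_or_pos j with rfl | hj0
    · simp [extA_zero]
    rcases hj.eq_or_lt with rfl | hjn
    · rw [extA_last, if_neg (by omega)]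
      simp
    · obtain ⟨i, rfl⟩ := Nat.exists_eq_add_of_lt hj0
      rw [zero_add] at *
      rw [extA_succ ((typeA n).u s) ⟨i, by omega⟩, hu]
      simp only [Nat.add_le_add_iff_right, Nat.add_sub_add_right]
  have hab : ((s : ℕ) + 1) * a = (n - s) * b := by
    generalize Nat.gcd ((s : ℕ) + 1) (n - s) = d at ha hb
    rw [ha, hb]
    ring
  have hc : pairing ℤ (typeA n).cox s ((typeA n).u s) = a + b := by
    change pairing ℤ (CoxeterMatrix.A n) s _ = _
    rw [pairing_extA, hext _ (by omega), hext _ (by omega), hext _ (by omega), if_pos le_rfl,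
      if_pos (Nat.le_succ _), if_neg (by omega)]
    obtain ⟨e, he⟩ : ∃ e, n - (s : ℕ) = e + 1 := ⟨n - s - 1, by omega⟩
    have he' : n + 1 - (s + 2 : ℕ) = e := by omega
    rw [he']
    rw [he] at hab
    have := congrArg (fun x : ℕ => (x : ℤ)) hab
    push_cast at this ⊢
    linear_combination this
  rw [hc] at h
  have hodd : Odd (a + b) := by exact_mod_cast h
  have hd2 : Even (((s : ℕ) + 1).gcd (n - s)) := by
    have h1 : n + 1 = ((s : ℕ) + 1).gcd (n - s) * (a + b) := by
      rw [mul_add, ← ha, ← hb]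
      omega
    have h2 : Even (n + 1) := hn.add_one
    rw [h1, Nat.even_mul] at h2
    exact h2.resolve_right (Nat.not_even_iff_odd.2 hodd)
  -- As a + b is odd, one of a and b is even. The coordinates up to `s` are multiples of a, those
  -- beyond `s` multiples of b; so ū_s is supported on a path going from `s` to one end of the
  -- chain.
  rcases Nat.even_or_odd a with hea | hoa
  · obtain ⟨t, p, hp, hsupp⟩ := exists_path_up s
    refine (typeA n).not_speciallyAdmissible_of_path p hp fun j hj => (hsupp j).2 ?_
    by_contra hlt
    rw [hu, if_pos (by rw [Fin.le_def] at hlt; omega)] at hj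
    exact Int.not_odd_iff_even.2 (by exact_mod_cast hea.mul_left _) hj
  · have heb : Even b := by
      rcases Nat.even_or_odd b with h | h
      · exact h
      · exact absurd (hoa.add_odd h) (Nat.not_even_iff_odd.2 hodd)
    obtain ⟨t, p, hp, hsupp⟩ := exists_path_down s
    refine (typeA n).not_speciallyAdmissible_of_path p hp fun j hj => (hsupp j).2 ?_
    by_contra hlt
    rw [hu, if_neg (by rw [Fin.le_def] at hlt; omega)] at hj
    exact Int.not_odd_iff_even.2 (by exact_mod_cast heb.mul_left _) hj

end WeylExt

end

/-! ### Cyclic subgroups generated by an element (0, 𝐮, g), and type A -/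

noncomputable section

namespace WeylExt

namespace Symbol

variable {ι : Type*} [Fintype ι] [DecidableEq ι]

theorem triple_pow_fst (Ψ : Symbol ι) {m : ℕ} (s : Fin m → ι) (u : Ψ.V s) (g : Ψ.W) (k : ℕ) :
    (Ψ.triple s 0 u g ^ k).1 = 1 := by
  rw [Prod.pow_fst]
  exact one_pow k

theorem triple_pow_right (Ψ : Symbol ι) {m : ℕ} (s : Fin m → ι) (x : Ψ.NonSpecial s → ZMod 2)
    (u : Ψ.V s) (g : Ψ.W) (k : ℕ) : (Ψ.triple s x u g ^ k).2.right = g ^ k := by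
  rw [Prod.pow_snd]
  exact map_pow (SemidirectProduct.rightHom : Ψ.Semi s →* Ψ.W) _ k

theorem triple_pow_left (Ψ : Symbol ι) {m : ℕ} (s : Fin m → ι) (x : Ψ.NonSpecial s → ZMod 2)
    (u : Ψ.V s) (g : Ψ.W) (k : ℕ) (i : Fin m) :
    ((Ψ.triple s x u g ^ k).2.left.toAdd i : ι → ZMod 2) =
      ∑ j ∈ Finset.range k, Ψ.rep (ZMod 2) (g ^ j) (u i) := by
  induction k with
  | zero => simp
  | succ k ih =>
    have : ((Ψ.triple s x u g ^ (k + 1)).2.left.toAdd i : ι → ZMod 2) =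
        ((Ψ.triple s x u g ^ k).2.left.toAdd i : ι → ZMod 2) +
          Ψ.rep (ZMod 2) ((Ψ.triple s x u g ^ k).2.right) (u i) := by
      rw [pow_succ]
      rfl
    rw [this, ih, triple_pow_right, Finset.sum_range_succ]

theorem triple_pow_eq_one (Ψ : Symbol ι) {m : ℕ} (s : Fin m → ι) (u : Ψ.V s) (g : Ψ.W) (k : ℕ)
    (hg : g ^ k = 1)
    (hu : ∀ i, ∑ j ∈ Finset.range k, Ψ.rep (ZMod 2) (g ^ j) (u i) = 0) :
    Ψ.triple s 0 u g ^ k = 1 := by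
  refine Prod.ext (Ψ.triple_pow_fst s u g k) (SemidirectProduct.ext ?_ ?_)
  · apply Multiplicative.toAdd.injective
    funext i
    apply Subtype.ext
    rw [triple_pow_left, hu]
    rfl
  · rw [triple_pow_right, hg]
    rfl

/-- The element `(0, 𝐮, g)` with a vector `𝐮` supported in one position. -/
theorem exists_torsionFree_comap (Ψ : Symbol ι) {m : ℕ} (hm : 1 ≤ m) (s : Fin m → ι)
    (hconn : Ψ.graph.Preconnected)
    (hodd : ∀ a, Odd (pairing ℤ Ψ.cox (s a) (Ψ.u (s a))))
    (hspecial : ∀ a, Ψ.SpeciallyAdmissible (s a) → Ψ.NoOddRelation (s a))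
    (g : Ψ.W) (k : ℕ) (hg : g ^ 2 ^ (k + 1) = 1)
    (hfix : ∀ Y, Ψ.rep ℤ (g ^ 2 ^ k) Y = Y → (4 : ℤ) ∣ Ψ.form Y Y)
    (z y : ι → ℤ) (hz : ∑ j ∈ Finset.range (2 ^ k), Ψ.rep ℤ (g ^ j) z = y)
    (hy : red (Ψ.rep ℤ (g ^ 2 ^ k) y) = red y) (hy4 : ¬ (4 : ℤ) ∣ Ψ.form y y) :
    ∃ u : Ψ.V s, Nonempty (Subgroup.zpowers (Ψ.triple s 0 u g) ≃*
        Multiplicative (ZMod (2 ^ (k + 1)))) ∧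
      TorsionFree ((Subgroup.zpowers (Ψ.triple s 0 u g)).comap (Ψ.phiHat s)) := by
  have hsum : ∑ j ∈ Finset.range (2 ^ k), Ψ.rep (ZMod 2) (g ^ j) (red z) = red y := by
    rw [← hz, red_sum]
    exact Finset.sum_congr rfl fun j _ => Ψ.rep_red _ _
  -- The second half of the sum is the translate of the first by g^(2^k), which fixes the class of
  -- `y`; the two halves cancel.
  have hsum2 : ∑ j ∈ Finset.range (2 ^ (k + 1)), Ψ.rep (ZMod 2) (g ^ j) (red z) = 0 := by
    have h2 : ∑ j ∈ Finset.range (2 ^ k), Ψ.rep (ZMod 2) (g ^ (2 ^ k + j)) (red z) = red y := by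
      simp only [pow_add, map_mul, Module.End.mul_apply]
      rw [← map_sum, hsum, rep_red, hy]
    rw [pow_succ, mul_two, Finset.sum_range_add, hsum, h2, add_self_pi_zmod_two]
  let i : Fin m := ⟨0, hm⟩
  let u : Ψ.V s := Pi.single i ⟨red z, by
    rw [Ψ.Lam_eq_top hconn _ (hodd i)]
    exact Submodule.mem_top⟩
  have hui : (u i : ι → ZMod 2) = red z := by simp [u]
  have hζ : Ψ.triple s 0 u g ^ 2 ^ (k + 1) = 1 := by
    refine Ψ.triple_pow_eq_one s u g _ hg fun j => ?_
    by_cases hj : j = i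
    · subst hj
      rw [hui, hsum2]
    · have : (u j : ι → ZMod 2) = 0 := by simp [u, hj]
      simp [this]
  have hleft : ((Ψ.triple s 0 u g ^ 2 ^ k).2.left.toAdd i : ι → ZMod 2) = red y := by
    rw [triple_pow_left, hui, hsum]
  refine ⟨u, ⟨?_⟩, Ψ.torsionFree_comap_zpowers s hodd hspecial _ k hζ ?_ i y hleft hy4⟩
  -- Otherwise `y` would lie in 2L and its norm would be divisible by 4.
  · have hne : Ψ.triple s 0 u g ^ 2 ^ k ≠ 1 := by
      intro h
      rw [h] at hleft
      obtain ⟨y', hy'⟩ := exists_eq_two_smul_of_red_eq_zero hleft.symm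
      apply hy4
      rw [hy']
      simp only [map_smul, LinearMap.smul_apply, smul_eq_mul, ← mul_assoc]
      exact Dvd.intro _ rfl
    have ho : Nat.card (Subgroup.zpowers (Ψ.triple s 0 u g)) = 2 ^ (k + 1) := by
      rw [Nat.card_zpowers]
      exact orderOf_eq_prime_pow hne hζ
    have e := zmodCyclicMulEquiv (G := Subgroup.zpowers (Ψ.triple s 0 u g)) inferInstance
    rw [ho] at e
    exact e.symm
  · intro Y hY
    rw [triple_pow_right] at hY
    exact hfix Y hY

end Symbol

open WeylExt.Symbol

theorem exists_torsionFree_comap_typeA {n : ℕ} (hn : Odd n) {m : ℕ} (hm : 1 ≤ m)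
    (s : Fin m → Fin n) (hs : ∀ i, (typeA n).Admissible (s i)) :
    ∃ u : (typeA n).V s, Nonempty (Subgroup.zpowers ((typeA n).triple s 0 u
        (coxeterElementA n ^ (coxeterNumberA n / 2))) ≃* Multiplicative (ZMod 2)) ∧
      TorsionFree ((Subgroup.zpowers ((typeA n).triple s 0 u
        (coxeterElementA n ^ (coxeterNumberA n / 2)))).comap ((typeA n).phiHat s)) := by
  obtain ⟨N, hN⟩ : ∃ N, n + 1 = 2 * N := hn.add_one.two_dvd
  have hN0 : 0 < N := by omega
  have hh : coxeterNumberA n = 2 * N := (coxeterNumberA_eq hn.pos).trans hN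
  have hg : (coxeterElementA n ^ N) ^ 2 = 1 := by
    rw [← pow_mul, mul_comm, ← hh]
    exact pow_orderOf_eq_one _
  have hodd := fun a => (typeA n).odd_pairing_of_admissible (s a) (hs a)
  rw [hh, Nat.mul_div_cancel_left N two_pos]
  refine (typeA n).exists_torsionFree_comap hm s (preconnected_typeA n) hodd
    (fun a h => absurd h (not_speciallyAdmissible_typeA hn (s a) (hodd a)))
    -- Here `k = 0`: the generator is itself an involution, and 𝐮 is the class of the root ε_0 - ε_N
    -- in one position.
    (coxeterElementA n ^ N) 0 hg (fun Y hY => four_dvd_form_of_fixed n hN Y (by simpa using hY))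
    (halfRootA n N) (halfRootA n N) (by simp) ?_ ?_
  · rw [pow_zero, pow_one, rep_halfRootA hN0 hN]
    funext j
    simp [red, CharTwo.neg_eq]
  · rw [form_halfRootA hN0 hN]
    omega

end WeylExt

end

noncomputable section

namespace WeylExt

open WeylExt.Symbol

/-! ### Type `E6` -/

theorem pairing_typeE6 (t : Fin 6) (v : Fin 6 → ℤ) : pairing ℤ typeE6.cox t v =
    ![2 * v 0 - v 1, 2 * v 1 - v 0 - v 2, 2 * v 2 - v 1 - v 3 - v 5, 2 * v 3 - v 2 - v 4,
      2 * v 4 - v 3, 2 * v 5 - v 2] t := by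
  have hc : cartan typeE6.cox = !![2, -1, 0, 0, 0, 0;
          -1, 2, -1, 0, 0, 0;
          0, -1, 2, -1, 0, -1;
          0, 0, -1, 2, -1, 0;
          0, 0, 0, -1, 2, 0;
          0, 0, -1, 0, 0, 2] := by
    funext i j
    fin_cases i <;> fin_cases j <;> rfl
  simp only [pairing, hc, LinearMap.coe_mk, AddHom.coe_mk, Fin.sum_univ_six]
  fin_cases t <;> simp <;> ring

/-- The reflection in a simple root of `E_6`, in coordinates. -/
def reflE6 (t : Fin 6) (v : Fin 6 → ℤ) : Fin 6 → ℤ :=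
  Function.update v t
    (![v 1 - v 0, v 0 + v 2 - v 1, v 1 + v 3 + v 5 - v 2, v 2 + v 4 - v 3, v 3 - v 4,
      v 2 - v 5] t)

theorem reflection_typeE6 (t : Fin 6) (v : Fin 6 → ℤ) :
    reflection ℤ typeE6.cox t v = reflE6 t v := by
  rw [reflection_apply, pairing_typeE6]
  funext j
  by_cases h : j = t
  · subst h
    fin_cases j <;> simp [reflE6] <;> ring
  · simp [reflE6, h]

theorem rep_coxeterElementD5 (v : Fin 6 → ℤ) : typeE6.rep ℤ coxeterElementD5 v =
    ![v 0, v 0 + v 2 - v 4 - v 5, v 1 + v 2 - v 4 - v 5, v 2 - v 4, v 3 - v 4, v 2 - v 5] := by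
  simp only [coxeterElementD5, map_mul, Module.End.mul_apply, rep_simple, reflection_typeE6]
  funext j
  fin_cases j <;> simp [reflE6] <;> ring

theorem rep_coxeterElementD5_sq (v : Fin 6 → ℤ) : typeE6.rep ℤ (coxeterElementD5 ^ 2) v =
    ![v 0, v 0 + v 1 - v 3, v 0 + v 1 + v 2 - v 3 - v 4 - v 5, v 1 + v 2 - v 3 - v 5,
      v 2 - v 3, v 1 - v 4] := by
  simp only [pow_two, map_mul, Module.End.mul_apply, rep_coxeterElementD5]
  funext j
  fin_cases j <;> simp <;> ring

theorem rep_coxeterElementD5_pow_four (v : Fin 6 → ℤ) :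
    typeE6.rep ℤ (coxeterElementD5 ^ 4) v =
      ![v 0, 2 * v 0 - v 2 + v 5, 3 * v 0 - v 2, 2 * v 0 - v 3, v 0 - v 4, v 0 + v 1 - v 2] := by
  rw [show 4 = 2 * 2 from rfl, pow_mul, pow_two (coxeterElementD5 ^ 2)]
  simp only [map_mul, Module.End.mul_apply, rep_coxeterElementD5_sq]
  funext j
  fin_cases j <;> simp <;> ring

theorem coxeterElementD5_pow_eight : coxeterElementD5 ^ 8 = 1 := by
  refine typeE6.rep_int_injective (LinearMap.ext fun v => ?_)
  rw [show 8 = 4 * 2 from rfl, pow_mul, pow_two (coxeterElementD5 ^ 4)]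
  simp only [map_mul, map_one, Module.End.mul_apply, Module.End.one_apply,
    rep_coxeterElementD5_pow_four]
  funext j
  fin_cases j <;> simp <;> ring

theorem form_typeE6 (v : Fin 6 → ℤ) : typeE6.form v v =
    2 * (v 0 ^ 2 + v 1 ^ 2 + v 2 ^ 2 + v 3 ^ 2 + v 4 ^ 2 + v 5 ^ 2 - v 0 * v 1 - v 1 * v 2 -
      v 2 * v 3 - v 3 * v 4 - v 2 * v 5) := by
  rw [form_apply, Fin.sum_univ_six]
  simp only [pairing_typeE6]
  simp
  ring

/-- The fixed vectors are (2b, b + c, 3b, 2b, b, c), with norm 4(3b² - 3bc + c²). -/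
theorem four_dvd_form_typeE6 (Y : Fin 6 → ℤ)
    (hY : typeE6.rep ℤ (coxeterElementD5 ^ 4) Y = Y) : (4 : ℤ) ∣ typeE6.form Y Y := by
  rw [rep_coxeterElementD5_pow_four] at hY
  have h1 : 2 * Y 0 - Y 2 + Y 5 = Y 1 := congrFun hY 1
  have h2 : 3 * Y 0 - Y 2 = Y 2 := congrFun hY 2
  have h3 : 2 * Y 0 - Y 3 = Y 3 := congrFun hY 3
  have h4 : Y 0 - Y 4 = Y 4 := congrFun hY 4
  have e0 : Y 0 = 2 * Y 4 := by linarith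
  have e2 : Y 2 = 3 * Y 4 := by linarith
  have e3 : Y 3 = 2 * Y 4 := by linarith
  have e1 : Y 1 = Y 4 + Y 5 := by linarith
  rw [form_typeE6, e0, e1, e2, e3]
  exact ⟨3 * Y 4 ^ 2 - 3 * (Y 4 * Y 5) + Y 5 ^ 2, by ring⟩

theorem preconnected_typeE6 : typeE6.graph.Preconnected := by
  have h : ∀ i j : Fin 6, coxE6 i j = 3 → typeE6.graph.Reachable i j := fun i j h =>
    SimpleGraph.Adj.reachable h
  have h2 : ∀ i, typeE6.graph.Reachable i 2 := by
    intro i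
    fin_cases i
    · exact (h 0 1 rfl).trans (h 1 2 rfl)
    · exact h 1 2 rfl
    · exact .refl _
    · exact h 3 2 rfl
    · exact (h 4 3 rfl).trans (h 3 2 rfl)
    · exact h 5 2 rfl
  exact fun i j => (h2 i).trans (h2 j).symm

/-- The last node is the only specially admissible one. -/
theorem eq_five_of_speciallyAdmissible (t : Fin 6) (ht : typeE6.SpeciallyAdmissible t) :
    t = 5 := by
  have adj : ∀ i j : Fin 6, coxE6 i j = 3 → typeE6.graph.Adj i j := fun _ _ h => h
  have h : ∀ (t t' : Fin 6) (p : typeE6.graph.Walk t t'), p.support.Nodup →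
      (∀ j, Odd (uE6 t j) → j ∈ p.support) → ¬ typeE6.SpeciallyAdmissible t := fun t t' p hp hj =>
    typeE6.not_speciallyAdmissible_of_path p (SimpleGraph.Walk.isPath_def p |>.2 hp) hj
  revert ht
  -- The odd coordinates of `uE6` for the nodes 0 to 4 are at {1, 5}, {0}, {5}, {4}, {3, 5}, each
  -- contained in a path from the node. For the node 5 they are at 0, 2, 4, which lie on no common
  -- path starting at 5.
  fin_cases t
  · exact fun ht => absurd ht (h 0 5 (.cons (adj 0 1 rfl) (.cons (adj 1 2 rfl)
      (.cons (adj 2 5 rfl) .nil))) (by simp) (by simp; decide))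
  · exact fun ht => absurd ht (h 1 0 (.cons (adj 1 0 rfl) .nil) (by simp) (by simp; decide))
  · exact fun ht => absurd ht (h 2 5 (.cons (adj 2 5 rfl) .nil) (by simp) (by simp; decide))
  · exact fun ht => absurd ht (h 3 4 (.cons (adj 3 4 rfl) .nil) (by simp) (by simp; decide))
  · exact fun ht => absurd ht (h 4 5 (.cons (adj 4 3 rfl) (.cons (adj 3 2 rfl)
      (.cons (adj 2 5 rfl) .nil))) (by simp) (by simp; decide))
  · exact fun _ => rfl

/-- Here u is a root and c = 1, so r such vectors have Gram matrix I + J, with J the all-ones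
matrix. It is positive definite, so they are independent and r ≤ 6. Their sum has norm r + r², that
is 2, 12 or 30 for r = 1, 3, 5, whereas a vector of 2L has norm divisible by 8. -/
theorem noOddRelation_typeE6 : typeE6.NoOddRelation 5 := by
  intro r f hr hself hne hred
  have hu : typeE6.form (typeE6.u 5) (typeE6.u 5) = 2 := by
    rw [form_typeE6]
    rfl
  have hp : pairing ℤ typeE6.cox 5 (typeE6.u 5) = 1 := by
    rw [pairing_typeE6]
    rfl
  rw [hu, hp] at hne
  rw [hu] at hself
  have hgram : ∀ a : Fin r → ℤ, typeE6.form (∑ i, a i • f i) (∑ i, a i • f i) =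
      ∑ i, a i ^ 2 + (∑ i, a i) ^ 2 := by
    intro a
    simp only [map_sum, LinearMap.sum_apply, map_smul, LinearMap.smul_apply, smul_eq_mul]
    rw [pow_two (∑ i, a i), Finset.sum_mul_sum, ← Finset.sum_add_distrib]
    refine Finset.sum_congr rfl fun i _ => ?_
    have : ∀ j, a i * (a j * typeE6.form (f j) (f i)) =
        a i * a j + if j = i then a i ^ 2 else 0 := by
      intro j
      split_ifs with h
      · rw [h, hself]
        ring
      · rw [hne j i h]
        ring
    simp only [Finset.mul_sum, this, Finset.sum_add_distrib, Finset.sum_ite_eq', Finset.mem_univ,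
      if_true]
    ring
  have hind : LinearIndependent ℤ f := by
    rw [Fintype.linearIndependent_iff]
    intro a ha i
    have h0 := hgram a
    rw [ha, map_zero] at h0
    have h1 : 0 ≤ ∑ i, a i ^ 2 := Finset.sum_nonneg fun i _ => sq_nonneg _
    have h2 : ∑ i, a i ^ 2 = 0 := by nlinarith [sq_nonneg (∑ i, a i)]
    exact pow_eq_zero_iff two_ne_zero |>.1
      ((Finset.sum_eq_zero_iff_of_nonneg fun i _ => sq_nonneg _).1 h2 i (Finset.mem_univ i))
  have hr6 : r ≤ 6 := by simpa using hind.fintype_card_le_finrank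
  obtain ⟨Z, hZ⟩ := exists_eq_two_smul_of_red_eq_zero hred
  have h1 := hgram fun _ => 1
  simp only [one_smul, one_pow, Finset.sum_const, Finset.card_univ, Fintype.card_fin, nsmul_eq_mul,
    mul_one] at h1
  rw [hZ] at h1
  simp only [map_smul, LinearMap.smul_apply, smul_eq_mul] at h1
  obtain ⟨e, he⟩ := typeE6.even_form_self Z
  rw [he] at h1
  obtain ⟨q, rfl⟩ := hr
  have : q ≤ 2 := by omega
  interval_cases q <;> norm_num at h1 <;> omega

theorem exists_torsionFree_comap_typeE6 {m : ℕ} (hm : 1 ≤ m)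
    (s : Fin m → Fin 6) (hs : ∀ i, typeE6.Admissible (s i)) :
    ∃ u : typeE6.V s, Nonempty (Subgroup.zpowers (typeE6.triple s 0 u coxeterElementD5) ≃*
        Multiplicative (ZMod (2 ^ 3))) ∧
      TorsionFree ((Subgroup.zpowers (typeE6.triple s 0 u coxeterElementD5)).comap
        (typeE6.phiHat s)) := by
  refine typeE6.exists_torsionFree_comap hm s preconnected_typeE6
    (fun a => typeE6.odd_pairing_of_admissible (s a) (hs a))
    (fun a h => by
      rw [eq_five_of_speciallyAdmissible (s a) h]
      exact noOddRelation_typeE6)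
    coxeterElementD5 2 coxeterElementD5_pow_eight four_dvd_form_typeE6
    -- The first vector is the simple root outside D_5; the second is the sum of its images under 1,
    -- ξ, ξ², ξ³, of norm 18.
    ![1, 0, 0, 0, 0, 0] ![4, 4, 3, 1, 0, 1] ?_ ?_ ?_
  · simp only [Finset.sum_range_succ, Finset.sum_range_zero, Nat.reducePow, pow_zero, pow_one,
      pow_succ _ 2, map_mul, map_one, Module.End.mul_apply, Module.End.one_apply,
      rep_coxeterElementD5_sq, rep_coxeterElementD5]
    decide
  · rw [show 2 ^ 2 = 4 from rfl, rep_coxeterElementD5_pow_four]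
    decide
  · rw [form_typeE6]
    decide

end WeylExt

end

/-! ### Orbits, stabilizers and the order of W(E_6) -/

noncomputable section

namespace WeylExt

namespace Symbol

variable {ι : Type*} [Fintype ι] [DecidableEq ι] (Ψ : Symbol ι)

/-- The elements of `W(Ψ)` fixing the vectors `u_t` for `t ∈ T`. -/
def fixer (T : Finset ι) : Subgroup Ψ.W where
  carrier := {g | ∀ t ∈ T, Ψ.rep ℤ g (Ψ.u t) = Ψ.u t}
  one_mem' t _ := by simp
  mul_mem' {a b} ha hb t ht := by rw [map_mul, Module.End.mul_apply, hb t ht, ha t ht]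
  inv_mem' {a} ha t ht := by
    nth_rewrite 1 [← ha t ht]
    rw [← Module.End.mul_apply, ← map_mul, inv_mul_cancel, map_one, Module.End.one_apply]

theorem simple_mem_fixer {T : Finset ι} {i : ι} (hi : i ∉ T) : Ψ.cox.simple i ∈ Ψ.fixer T := by
  intro t ht
  have : i ≠ t := fun h => hi (h ▸ ht)
  rw [rep_simple, reflection_apply, Ψ.u_orth t i this, zero_smul, sub_zero]

/-- The stabilizer of dominant vectors is generated by simple reflections. -/
theorem fixer_le_closure (hpos : ∀ t, 0 < pairing ℤ Ψ.cox t (Ψ.u t)) (T : Finset ι) :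
    Ψ.fixer T ≤ Subgroup.closure (Ψ.cox.simple '' {i | i ∉ T}) := by
  intro g hg
  induction hn : Ψ.cox.toCoxeterSystem.length g using Nat.strong_induction_on generalizing g with
  | _ n ih =>
  by_cases h1 : g = 1
  · rw [h1]
    exact one_mem _
  obtain ⟨i, hi⟩ := Ψ.cox.toCoxeterSystem.exists_rightDescent_of_ne_one h1
  -- A descent `i` in T is impossible: g fixes u_i, so (u_i, x_i) = (u_i, g x_i). The left side is
  -- positive, while g x_i ≤ 0 and u_i is dominant.
  have hiT : i ∉ T := by
    intro hiT
    have hle := cartanRep_single_nonpos Ψ.isCartan_cartan g i hi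
    rw [← rep_eq_cartanRep] at hle
    have h2 := Ψ.form_rep g (Ψ.u i) (Pi.single i 1)
    rw [hg i hiT, form_single_right, form_apply] at h2
    have h3 := hpos i
    rw [← h2] at h3
    refine h3.not_ge (Finset.sum_nonpos fun j _ => mul_nonpos_of_nonneg_of_nonpos ?_ (hle j))
    by_cases hj : j = i
    · rw [hj]
      exact (hpos i).le
    · rw [Ψ.u_orth i j hj]
  have hmem : g * Ψ.cox.simple i ∈ Subgroup.closure (Ψ.cox.simple '' {i | i ∉ T}) :=
    ih _ (hn ▸ hi) (mul_mem hg (Ψ.simple_mem_fixer hiT)) rfl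
  have := mul_mem hmem (Subgroup.subset_closure (Set.mem_image_of_mem Ψ.cox.simple hiT))
  rwa [mul_assoc, simple_mul_self, mul_one] at this

theorem fixer_univ (hpos : ∀ t, 0 < pairing ℤ Ψ.cox t (Ψ.u t)) :
    Ψ.fixer Finset.univ = ⊥ := by
  have := Ψ.fixer_le_closure hpos Finset.univ
  simpa using this

/-- Orbit-stabilizer: `L` lists the orbit of `u_t` under the fixer of `T`. -/
theorem card_fixer (hpos : ∀ t, 0 < pairing ℤ Ψ.cox t (Ψ.u t)) (T : Finset ι) (t : ι)
    (L : List (ι → ℤ)) (hL : L.Nodup) (ht : Ψ.u t ∈ L)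
    (hclosed : ∀ x ∈ L, ∀ i ∉ T, reflection ℤ Ψ.cox i x ∈ L)
    (hdesc : ∀ x ∈ L, x = Ψ.u t ∨ ∃ i ∉ T, pairing ℤ Ψ.cox i x < 0) :
    Nat.card (Ψ.fixer T) = L.length * Nat.card (Ψ.fixer (insert t T)) := by
  let _ : MulAction (Ψ.fixer T) (ι → ℤ) :=
    { smul := fun g v => Ψ.rep ℤ g v
      one_smul := fun v => by
        change Ψ.rep ℤ 1 v = v
        simp
      mul_smul := fun g h v => by
        change Ψ.rep ℤ (g * h) v = Ψ.rep ℤ g (Ψ.rep ℤ h v)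
        simp }
  have smul_def : ∀ (g : Ψ.fixer T) (v : ι → ℤ), g • v = Ψ.rep ℤ g v := fun _ _ => rfl
  have horb : MulAction.orbit (Ψ.fixer T) (Ψ.u t) = {x | x ∈ L} := by
    ext x
    constructor
    · rintro ⟨g, rfl⟩
      change Ψ.rep ℤ g (Ψ.u t) ∈ L
      have hstab : ∀ x ∈ L, Ψ.rep ℤ g x ∈ L := by
        refine Subgroup.closure_induction (p := fun g _ => ∀ x ∈ L, Ψ.rep ℤ g x ∈ L)
          ?_ ?_ ?_ ?_ (Ψ.fixer_le_closure hpos T g.2)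
        · rintro _ ⟨i, hi, rfl⟩ x hx
          rw [rep_simple]
          exact hclosed x hx i hi
        · intro x hx
          simpa using hx
        · intro a b _ _ ha hb x hx
          rw [map_mul]
          exact ha _ (hb x hx)
        · intro a _ ha x hx
          -- Closure under inverses: an injective map of a finite set to itself is surjective.
          have hinj : Set.InjOn (Ψ.rep ℤ a) (L.toFinset : Set (ι → ℤ)) := fun y _ z _ h => by
            have := congrArg (Ψ.rep ℤ a⁻¹) h
            simpa [← Module.End.mul_apply, ← map_mul] using this
          have hmaps : Set.MapsTo (Ψ.rep ℤ a) (L.toFinset : Set (ι → ℤ)) L.toFinset := fun y hy => by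
            simpa using ha y (by simpa using hy)
          obtain ⟨y, hy, rfl⟩ := Finset.surjOn_of_injOn_of_card_le _ hmaps hinj le_rfl
            (show x ∈ (L.toFinset : Set (ι → ℤ)) by simpa using hx)
          rw [← Module.End.mul_apply, ← map_mul, inv_mul_cancel, map_one, Module.End.one_apply]
          simpa using hy
      exact hstab _ ht
    · intro hx
      -- A reflection with negative pairing increases the sum of the coordinates, which is bounded
      -- on `L` by this constant; climbing therefore ends at u_t.
      let M : ℤ := ∑ y ∈ L.toFinset, |∑ j, y j|
      have hM : ∀ y ∈ L, ∑ j, y j ≤ M := fun y hy =>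
        (le_abs_self _).trans (Finset.single_le_sum (f := fun y : ι → ℤ => |∑ j, y j|)
          (fun _ _ => abs_nonneg _) (List.mem_toFinset.2 hy))
      induction hn : (M - ∑ j, x j).toNat using Nat.strong_induction_on generalizing x with
      | _ n ih =>
      rcases hdesc x hx with rfl | ⟨i, hi, hneg⟩
      · exact MulAction.mem_orbit_self _
      · have hx' := hclosed x hx i hi
        have hsum : ∑ j, reflection ℤ Ψ.cox i x j = ∑ j, x j - pairing ℤ Ψ.cox i x := by
          simp [reflection_apply, Finset.sum_sub_distrib, ← Finset.mul_sum]
        have := ih (M - ∑ j, reflection ℤ Ψ.cox i x j).toNat (by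
          have := hM _ hx'
          have := hM _ hx
          omega) _ hx' rfl
        have h2 := MulAction.mem_orbit_of_mem_orbit (⟨_, Ψ.simple_mem_fixer hi⟩ : Ψ.fixer T) this
        rw [smul_def] at h2
        simpa only [rep_simple, ← Module.End.mul_apply, reflection_sq, Module.End.one_apply] using h2
  have hstab : MulAction.stabilizer (Ψ.fixer T) (Ψ.u t) =
      (Ψ.fixer (insert t T)).subgroupOf (Ψ.fixer T) := by
    ext g
    rw [MulAction.mem_stabilizer_iff, smul_def, Subgroup.mem_subgroupOf]
    refine ⟨fun h t' ht' => ?_, fun h => h t (Finset.mem_insert_self t T)⟩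
    rcases Finset.mem_insert.1 ht' with rfl | ht'
    · exact h
    · exact g.2 t' ht'
  have hle : Ψ.fixer (insert t T) ≤ Ψ.fixer T := fun g hg t' ht' =>
    hg t' (Finset.mem_insert_of_mem ht')
  rw [← Subgroup.index_mul_card (MulAction.stabilizer (Ψ.fixer T) (Ψ.u t)),
    MulAction.index_stabilizer, horb, hstab,
    Nat.card_congr (Subgroup.subgroupOfEquivOfLe hle).toEquiv]
  congr 1
  rw [← List.coe_toFinset, Set.ncard_coe_finset, List.toFinset_card_of_nodup hL]

end Symbol

end WeylExt

end

noncomputable section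

namespace WeylExt

open WeylExt.Symbol

/-- The orbit of the vector `u` of node 0. -/
def orbitE6Zero : List (Fin 6 → ℤ) :=
  [![4, 5, 6, 4, 2, 3], ![1, 5, 6, 4, 2, 3], ![1, 2, 6, 4, 2, 3],
   ![1, 2, 3, 4, 2, 3], ![1, 2, 3, 1, 2, 3], ![1, 2, 3, 4, 2, 0],
   ![1, 2, 3, 1, -1, 3], ![1, 2, 3, 1, 2, 0], ![1, 2, 3, 1, -1, 0],
   ![1, 2, 0, 1, 2, 0], ![1, 2, 0, 1, -1, 0], ![1, -1, 0, 1, 2, 0],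
   ![1, -1, 0, 1, -1, 0], ![1, 2, 0, -2, -1, 0], ![-2, -1, 0, 1, 2, 0],
   ![-2, -1, 0, 1, -1, 0], ![1, -1, 0, -2, -1, 0], ![-2, -1, 0, -2, -1, 0],
   ![1, -1, -3, -2, -1, 0], ![-2, -1, -3, -2, -1, 0], ![1, -1, -3, -2, -1, -3],
   ![-2, -4, -3, -2, -1, 0], ![-2, -1, -3, -2, -1, -3], ![-2, -4, -3, -2, -1, -3],
   ![-2, -4, -6, -2, -1, -3], ![-2, -4, -6, -5, -1, -3], ![-2, -4, -6, -5, -4, -3]]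

/-- The orbit of the vector `u` of node 4 under the subgroup that fixes those of the nodes 0. -/
def orbitE6Four : List (Fin 6 → ℤ) :=
  [![2, 4, 6, 5, 4, 3], ![2, 4, 6, 5, 1, 3], ![2, 4, 6, 2, 1, 3],
   ![2, 4, 3, 2, 1, 3], ![2, 1, 3, 2, 1, 3], ![2, 4, 3, 2, 1, 0],
   ![2, 1, 3, 2, 1, 0], ![2, 1, 0, 2, 1, 0], ![2, 1, 0, -1, 1, 0],
   ![2, 1, 0, -1, -2, 0]]

/-- The orbit of the vector `u` of node 3 under the subgroup that fixes those of the nodes 0, 4. -/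
def orbitE6Three : List (Fin 6 → ℤ) :=
  [![4, 8, 12, 10, 5, 6], ![4, 8, 12, 7, 5, 6], ![4, 8, 9, 7, 5, 6],
   ![4, 5, 9, 7, 5, 6], ![4, 8, 9, 7, 5, 3], ![4, 5, 9, 7, 5, 3],
   ![4, 5, 6, 7, 5, 3], ![4, 5, 6, 4, 5, 3]]

/-- The orbit of the vector `u` of node 1 under the subgroup that fixes those of the nodes 0, 4, 3. -/
def orbitE6One : List (Fin 6 → ℤ) :=
  [![5, 10, 12, 8, 4, 6], ![5, 7, 12, 8, 4, 6], ![5, 7, 9, 8, 4, 6],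
   ![5, 7, 9, 8, 4, 3]]

/-- The orbit of the vector `u` of node 2 under the subgroup that fixes those of the nodes 0, 4, 3, 1. -/
def orbitE6Two : List (Fin 6 → ℤ) :=
  [![2, 4, 6, 4, 2, 3], ![2, 4, 5, 4, 2, 3], ![2, 4, 5, 4, 2, 2]]

/-- The orbit of the vector `u` of node 5 under the subgroup that fixes those of the nodes 0, 4, 3, 1, 2. -/
def orbitE6Five : List (Fin 6 → ℤ) :=
  [![1, 2, 3, 2, 1, 2], ![1, 2, 3, 2, 1, 1]]

theorem pairing_uE6_pos (t : Fin 6) : 0 < pairing ℤ typeE6.cox t (typeE6.u t) := by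
  rw [pairing_typeE6]
  revert t
  decide

theorem card_fixer_typeE6 (T : Finset (Fin 6)) (t : Fin 6) (L : List (Fin 6 → ℤ)) (hL : L.Nodup)
    (ht : uE6 t ∈ L) (hclosed : ∀ x ∈ L, ∀ i ∉ T, reflE6 i x ∈ L)
    (hdesc : ∀ x ∈ L, x = uE6 t ∨ ∃ i ∉ T, reflE6 i x i > x i) :
    Nat.card (typeE6.fixer T) = L.length * Nat.card (typeE6.fixer (insert t T)) := by
  refine typeE6.card_fixer pairing_uE6_pos T t L hL ht ?_ ?_
  · simpa only [reflection_typeE6] using hclosed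
  · intro x hx
    refine (hdesc x hx).imp_right fun ⟨i, hi, h⟩ => ⟨i, hi, ?_⟩
    rw [← reflection_typeE6, reflection_apply] at h
    have : x i < x i - pairing ℤ typeE6.cox i x := by simpa using h
    linarith

/-- The successive fixers are the visible subgroups of types D_5, D_4, A_3, A_2, A_1 and the trivial
one, with indices 27, 10, 8, 4, 3, 2 along the chain. -/
theorem card_W_typeE6 : Nat.card typeE6.W = 51840 := by
  have h0 := card_fixer_typeE6 ∅ 0 orbitE6Zero (by decide +kernel) (by decide +kernel)
    (by decide +kernel) (by decide +kernel)
  have h4 := card_fixer_typeE6 {0} 4 orbitE6Four (by decide +kernel) (by decide +kernel)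
    (by decide +kernel) (by decide +kernel)
  have h3 := card_fixer_typeE6 {4, 0} 3 orbitE6Three (by decide +kernel) (by decide +kernel)
    (by decide +kernel) (by decide +kernel)
  have h1 := card_fixer_typeE6 {3, 4, 0} 1 orbitE6One (by decide +kernel) (by decide +kernel)
    (by decide +kernel) (by decide +kernel)
  have h2 := card_fixer_typeE6 {1, 3, 4, 0} 2 orbitE6Two (by decide +kernel) (by decide +kernel)
    (by decide +kernel) (by decide +kernel)
  have h5 := card_fixer_typeE6 {2, 1, 3, 4, 0} 5 orbitE6Five (by decide +kernel) (by decide +kernel)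
    (by decide +kernel) (by decide +kernel)
  have htop : typeE6.fixer ∅ = ⊤ := by
    ext g
    simp [fixer, ← SetLike.mem_coe]
  have hbot : typeE6.fixer (insert 5 {2, 1, 3, 4, 0}) = ⊥ := by
    rw [← typeE6.fixer_univ pairing_uE6_pos]
    congr 1
    decide
  rw [← Subgroup.card_top, ← htop, h0, insert_empty_eq, h4, h3, h1, h2, h5, hbot, Subgroup.card_bot]
  rfl

end WeylExt

end

noncomputable section

namespace WeylExt

namespace Symbol

variable {ι : Type*} [Fintype ι] [DecidableEq ι] (Ψ : Symbol ι) {m : ℕ} (s : Fin m → ι)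

/-! ### Surjectivity of `φ̂` -/

theorem triple_mul (x y : Ψ.NonSpecial s → ZMod 2) (u v : Ψ.V s) (g h : Ψ.W) :
    Ψ.triple s x u g * Ψ.triple s y v h =
      Ψ.triple s (x + y) (u + (Ψ.act s g (Multiplicative.ofAdd v)).toAdd) (g * h) :=
  rfl

theorem triple_zero_mul (x y : Ψ.NonSpecial s → ZMod 2) (u v : Ψ.V s) :
    Ψ.triple s x u 1 * Ψ.triple s y v 1 = Ψ.triple s (x + y) (u + v) 1 := by
  rw [triple_mul, map_one, mul_one]
  rfl

theorem triple_conj (x : Ψ.NonSpecial s → ZMod 2) (v : Ψ.V s) (g : Ψ.W) :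
    Ψ.triple s 0 0 g * Ψ.triple s x v 1 * Ψ.triple s 0 0 g⁻¹ =
      Ψ.triple s x (Ψ.act s g (Multiplicative.ofAdd v)).toAdd 1 := by
  rw [triple_mul, triple_mul, mul_one, mul_inv_cancel, zero_add, zero_add, add_zero]
  congr 1
  rw [ofAdd_zero, map_one, toAdd_one, add_zero]

theorem triple_group_mem_range (g : Ψ.W) : Ψ.triple s 0 0 g ∈ (Ψ.phiHat s).range := by
  induction g using Ψ.cox.toCoxeterSystem.simple_induction_left with
  | one => exact one_mem _
  | mul_simple_left w i ih =>
    have h1 : Ψ.triple s 0 0 (Ψ.cox.simple i) ∈ (Ψ.phiHat s).range :=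
      ⟨(Ψ.extend s).simple (.inl i), Prod.ext
        ((Ψ.extend s).toCoxeterSystem.lift_apply_simple (Ψ.eps_liftable s) (.inl i))
        ((Ψ.extend s).toCoxeterSystem.lift_apply_simple (Ψ.phi_liftable s) (.inl i))⟩
    have h2 := mul_mem h1 ih
    rwa [triple_mul, ofAdd_zero, map_one, toAdd_one, add_zero, add_zero] at h2

theorem triple_uvec_mem_range (a : Fin m) :
    Ψ.triple s (fun i => if (i : Fin m) = a then 1 else 0) (Ψ.uvec s a) 1 ∈
      (Ψ.phiHat s).range :=
  ⟨(Ψ.extend s).simple (.inr a), Prod.ext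
    ((Ψ.extend s).toCoxeterSystem.lift_apply_simple (Ψ.eps_liftable s) (.inr a))
    ((Ψ.extend s).toCoxeterSystem.lift_apply_simple (Ψ.phi_liftable s) (.inr a))⟩

theorem add_self_V (v : Ψ.V s) : v + v = 0 := Ψ.mul_self_V s (Multiplicative.ofAdd v)

/-- The vectors `𝐮` with `(0, 𝐮, 1)` in the image of `φ̂`. -/
def rangeV : AddSubgroup (Ψ.V s) where
  carrier := {v | Ψ.triple s 0 v 1 ∈ (Ψ.phiHat s).range}
  zero_mem' := (Ψ.phiHat s).range.one_mem
  add_mem' {u v} hu hv := by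
    have := (Ψ.phiHat s).range.mul_mem hu hv
    rwa [triple_zero_mul, add_zero] at this
  neg_mem' {v} hv := by
    rwa [neg_eq_of_add_eq_zero_left (Ψ.add_self_V s v)]

theorem mem_rangeV {v : Ψ.V s} : v ∈ Ψ.rangeV s ↔ Ψ.triple s 0 v 1 ∈ (Ψ.phiHat s).range :=
  Iff.rfl

theorem act_mem_rangeV (g : Ψ.W) {v : Ψ.V s} (hv : v ∈ Ψ.rangeV s) :
    (Ψ.act s g (Multiplicative.ofAdd v)).toAdd ∈ Ψ.rangeV s := by
  rw [mem_rangeV] at hv ⊢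
  have := mul_mem (mul_mem (Ψ.triple_group_mem_range s g) hv) (Ψ.triple_group_mem_range s g⁻¹)
  rwa [triple_conj] at this

theorem act_single (g : Ψ.W) (a : Fin m) (v : Ψ.Lam (s a)) :
    (Ψ.act s g (Multiplicative.ofAdd (Pi.single a v : Ψ.V s))).toAdd =
      Pi.single a ⟨Ψ.rep (ZMod 2) g v, Ψ.rep_mem_Lam (s a) g v.2⟩ := by
  funext b
  apply Subtype.ext
  by_cases hb : b = a
  · subst hb
    simp [act]
  · simp [act, hb]

/-- The product of t_a with its conjugate by the generator of s_a has trivial ε-part, and its vector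
is ū_s plus its reflection: the simple root of s_a, since c is odd. By invariance and connectedness
this root generates all of L/2 in position `a`. -/
theorem single_mem_rangeV (hconn : Ψ.graph.Preconnected) (a : Fin m)
    (hodd : Odd (pairing ℤ Ψ.cox (s a) (Ψ.u (s a)))) (v : Ψ.Lam (s a)) :
    (Pi.single a v : Ψ.V s) ∈ Ψ.rangeV s := by
  let A : AddSubgroup (ι → ZMod 2) :=
    ((Ψ.rangeV s).comap (AddMonoidHom.single (fun i : Fin m => Ψ.Lam (s i)) a)).map
      (Ψ.Lam (s a)).subtype.toAddMonoidHom
  have hA : ∀ v : Ψ.Lam (s a), (v : ι → ZMod 2) ∈ A ↔ (Pi.single a v : Ψ.V s) ∈ Ψ.rangeV s := by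
    intro v
    constructor
    · rintro ⟨w, hw, h⟩
      obtain rfl : w = v := Subtype.ext h
      exact hw
    · exact fun h => ⟨v, h, rfl⟩
  have htop : AddSubgroup.toZModSubmodule 2 A = ⊤ := by
    refine Ψ.eq_top_of_single_mem hconn _ (fun i v hv => ?_) (s a) ?_
    · obtain ⟨w, hw, rfl⟩ := hv
      have := Ψ.act_mem_rangeV s (Ψ.cox.simple i) hw
      rw [AddMonoidHom.single_apply, act_single] at this
      rw [← rep_simple]
      exact (hA _).2 this
    · have h1 := Ψ.triple_uvec_mem_range s a
      have h2 := mul_mem (mul_mem (Ψ.triple_group_mem_range s (Ψ.cox.simple (s a))) h1)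
        (Ψ.triple_group_mem_range s (Ψ.cox.simple (s a))⁻¹)
      have h3 := mul_mem h1 h2
      rw [triple_conj, triple_zero_mul, add_self_pi_zmod_two, uvec, act_single, ← Pi.single_add,
        ← mem_rangeV] at h3
      have h4 := (hA _).2 h3
      rw [← Ψ.single_sub_ubar_of_odd _ hodd]
      have hsub : ∀ v w : ι → ZMod 2, v - w = v + w := fun v w => by
        rw [sub_eq_add_neg, neg_eq_of_add_eq_zero_left (add_self_pi_zmod_two w)]
      rw [hsub, ← rep_simple]
      exact h4
  refine (hA v).1 ?_
  have : (v : ι → ZMod 2) ∈ AddSubgroup.toZModSubmodule 2 A := htop ▸ Submodule.mem_top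
  exact this

theorem rangeV_eq_top (hconn : Ψ.graph.Preconnected)
    (hodd : ∀ a, Odd (pairing ℤ Ψ.cox (s a) (Ψ.u (s a)))) : Ψ.rangeV s = ⊤ := by
  rw [eq_top_iff]
  intro v _
  rw [← Finset.univ_sum_single v]
  exact AddSubgroup.sum_mem _ fun a _ => Ψ.single_mem_rangeV s hconn a (hodd a) (v a)

theorem phiHat_surjective (hconn : Ψ.graph.Preconnected)
    (hodd : ∀ a, Odd (pairing ℤ Ψ.cox (s a) (Ψ.u (s a)))) :
    Function.Surjective (Ψ.phiHat s) := by
  have hV : ∀ v : Ψ.V s, Ψ.triple s 0 v 1 ∈ (Ψ.phiHat s).range := fun v => by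
    rw [← mem_rangeV, Ψ.rangeV_eq_top s hconn hodd]
    exact AddSubgroup.mem_top v
  -- Once all (0, 𝐯, 1) are in the image, the vector part of the image of t_a can be cancelled.
  have hone : ∀ a : Fin m, Ψ.triple s (fun i => if (i : Fin m) = a then 1 else 0) 0 1 ∈
      (Ψ.phiHat s).range := fun a => by
    have := mul_mem (Ψ.triple_uvec_mem_range s a) (hV (Ψ.uvec s a))
    rwa [triple_zero_mul, add_zero, add_self_V] at this
  have hX : ∀ x : Ψ.NonSpecial s → ZMod 2, Ψ.triple s x 0 1 ∈ (Ψ.phiHat s).range := by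
    classical
    intro x
    let B : AddSubgroup (Ψ.NonSpecial s → ZMod 2) :=
      { carrier := {x | Ψ.triple s x 0 1 ∈ (Ψ.phiHat s).range}
        zero_mem' := (Ψ.phiHat s).range.one_mem
        add_mem' := fun {x y} hx hy => by
          have := (Ψ.phiHat s).range.mul_mem hx hy
          rwa [triple_zero_mul, add_zero] at this
        neg_mem' := fun {x} hx => by
          rwa [neg_eq_of_add_eq_zero_left (add_self_pi_zmod_two x)] }
    have hB : x ∈ B := by
      rw [← Finset.univ_sum_single x]
      refine AddSubgroup.sum_mem _ fun i _ => ?_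
      have hi : (Pi.single i 1 : Ψ.NonSpecial s → ZMod 2) ∈ B := by
        have h := hone i
        have he : (fun j : Ψ.NonSpecial s => if (j : Fin m) = i then (1 : ZMod 2) else 0) =
            Pi.single i 1 := by
          funext j
          simp [Pi.single_apply, Subtype.ext_iff]
        rwa [he] at h
      have := (AddSubgroup.toZModSubmodule 2 B).smul_mem (x i) hi
      rwa [← Pi.single_smul, smul_eq_mul, mul_one] at this
    exact hB
  rintro ⟨x, v, g⟩
  have := mul_mem (mul_mem (hX x.toAdd) (hV v.toAdd)) (Ψ.triple_group_mem_range s g)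
  rw [triple_zero_mul, triple_mul, one_mul, ofAdd_zero, map_one, toAdd_one, add_zero, add_zero,
    zero_add, add_zero] at this
  exact this

theorem card_target (hconn : Ψ.graph.Preconnected)
    (hodd : ∀ a, Odd (pairing ℤ Ψ.cox (s a) (Ψ.u (s a)))) :
    Nat.card (Ψ.Target s) =
      2 ^ (m * Fintype.card ι + Nat.card (Ψ.NonSpecial s)) * Nat.card Ψ.W := by
  classical
  have hL : ∀ a, Nat.card (Ψ.Lam (s a)) = 2 ^ Fintype.card ι := fun a => by
    rw [Ψ.Lam_eq_top hconn _ (hodd a), Nat.card_congr Submodule.topEquiv.toEquiv]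
    simp
  rw [Nat.card_prod, SemidirectProduct.card, Nat.card_congr Multiplicative.toAdd,
    Nat.card_congr Multiplicative.toAdd, Nat.card_pi, Nat.card_pi]
  simp only [hL, Nat.card_zmod, Finset.prod_const, Finset.card_univ, Fintype.card_fin,
    Nat.card_eq_fintype_card (α := Ψ.NonSpecial s)]
  ring

end Symbol

open WeylExt.Symbol

theorem index_comap_zpowers_typeE6 {m : ℕ} (hm : 1 ≤ m) (s : Fin m → Fin 6)
    (hs : ∀ i, typeE6.Admissible (s i)) (ζ : typeE6.Target s)
    (hζ : Nat.card (Subgroup.zpowers ζ) = 2 ^ 3) :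
    2 * ((Subgroup.zpowers ζ).comap (typeE6.phiHat s)).index =
      2 ^ (m * 6 + Nat.card (typeE6.NonSpecial s) - 2) * (exponentsE6.map (· + 1)).prod := by
  have hodd := fun a => typeE6.odd_pairing_of_admissible (s a) (hs a)
  rw [Subgroup.index_comap_of_surjective _ (typeE6.phiHat_surjective s preconnected_typeE6 hodd)]
  have h := Subgroup.index_mul_card (Subgroup.zpowers ζ)
  rw [hζ, typeE6.card_target s preconnected_typeE6 hodd, card_W_typeE6, Fintype.card_fin] at h
  have hp : (exponentsE6.map (· + 1)).prod = 51840 := rfl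
  -- As `1 ≤ m`, the exponent is at least 6 and the truncated subtraction of 2 is exact.
  obtain ⟨e, he⟩ : ∃ e, m * 6 + Nat.card (typeE6.NonSpecial s) = e + 2 :=
    ⟨m * 6 + Nat.card (typeE6.NonSpecial s) - 2, by omega⟩
  rw [he, pow_add] at h
  rw [hp, he, Nat.add_sub_cancel]
  omega

end WeylExt

end

theorem mainTheorem5 :
    (∀ (n : ℕ), Odd n → ∀ (m : ℕ), 1 ≤ m → ∀ s : Fin m → Fin n,
      (∀ i, (WeylExt.typeA n).Admissible (s i)) →
      ∃ u : (WeylExt.typeA n).V s,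
        let ζ := (WeylExt.typeA n).triple s 0 u
          (WeylExt.coxeterElementA n ^ (WeylExt.coxeterNumberA n / 2))
        Nonempty (Subgroup.zpowers ζ ≃* Multiplicative (ZMod 2)) ∧
        WeylExt.TorsionFree ((Subgroup.zpowers ζ).comap ((WeylExt.typeA n).phiHat s))) ∧
    (∀ (m : ℕ), 1 ≤ m → ∀ s : Fin m → Fin 6,
      (∀ i, WeylExt.typeE6.Admissible (s i)) →
      ∃ u : WeylExt.typeE6.V s,
        let ζ := WeylExt.typeE6.triple s 0 u WeylExt.coxeterElementD5
        Nonempty (Subgroup.zpowers ζ ≃* Multiplicative (ZMod (2 ^ 3))) ∧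
        WeylExt.TorsionFree ((Subgroup.zpowers ζ).comap (WeylExt.typeE6.phiHat s)) ∧
        2 * ((Subgroup.zpowers ζ).comap (WeylExt.typeE6.phiHat s)).index =
          2 ^ (m * 6 + Nat.card (WeylExt.typeE6.NonSpecial s) - 2) *
            (WeylExt.exponentsE6.map (· + 1)).prod) := by
  refine ⟨fun n hn m hm s hs => WeylExt.exists_torsionFree_comap_typeA hn hm s hs,
    fun m hm s hs => ?_⟩
  obtain ⟨u, ⟨e⟩, ht⟩ := WeylExt.exists_torsionFree_comap_typeE6 hm s hs
  refine ⟨u, ⟨e⟩, ht, WeylExt.index_comap_zpowers_typeE6 hm s hs _ ?_⟩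
  rw [Nat.card_congr (e.toEquiv.trans Multiplicative.toAdd), Nat.card_zmod]
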